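/- Let $d>0$ be a real constant and let $r\ge 1$ be a fixed integer. For every sufficiently large $n$ let $p=p(n)=d/n$, and let $G_{n,p}$ be the binomial random graph on $\{1,\dots,n\}$, in which each of the $\binom n2$ pairs of vertices is an edge independently with probability $p$. For a graph $G$, the $r$-th power $G^r$ is the graph on the same vertex set in which two distinct vertices are adjacent if and only if they are joined in $G$ by a path with at most $r$ edges; $\Delta(G^r)$ is its maximum degree. Let $\log_{(1)}x=\log x$ and $\log_{(k+1)}x=\log\log_{(k)}x$, where $\log$ is the natural logarithm. Then, with high probability, $\Delta(G_{n,p}^r)\sim \frac{\log n}{\log_{(r+1)}n}$; that is, for every $\varepsilon>0$, $$\lim_{n\to\infty}\mathbb P\left((1-\varepsilon)\frac{\log n}{\log_{(r+1)}n}\le \Delta(G_{n,p}^r)\le (1+\varepsilon)\frac{\log n}{\log_{(r+1)}n}\right)=1.$$ -/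

import Mathlib

open Filter Topology

/-- The `r`-th power of a graph: distinct vertices `u` and `v` are adjacent iff they are joined
by a path with at most `r` edges. -/
def SimpleGraph.graphPower {V : Type*} (G : SimpleGraph V) (r : ℕ) : SimpleGraph V where
  Adj u v := u ≠ v ∧ ∃ w : G.Walk u v, w.IsPath ∧ w.length ≤ r
  symm := ⟨fun _ _ h => ⟨h.1.symm, h.2.elim fun w hw =>
    ⟨w.reverse, hw.1.reverse, by simpa using hw.2⟩⟩⟩
  loopless := ⟨fun _ h => h.1 rfl⟩

open Classical in
/-- The maximum degree `Δ(G^r)` of the `r`-th power of a finite graph `G`. -/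
noncomputable def SimpleGraph.maxDegreePower {V : Type*} [Fintype V] (G : SimpleGraph V) (r : ℕ) :
    ℕ :=
  (G.graphPower r).maxDegree

/-- The iterated logarithm `log_{(k)} x`: the natural logarithm applied `k` times to `x`. -/
noncomputable def iteratedLog (k : ℕ) (x : ℝ) : ℝ :=
  Real.log^[k] x

/-!
Write `L k` for `log_{(k)} n` and `M = L 1 / L (r + 1)`. A vertex `v` has as many neighbours in
`G ^ r` as there are other vertices at distance at most `r` from it, and both tails of this number
are governed by the same picture: the cheapest way to reach `M` vertices is a tree in which a
vertex at distance `i ≥ 1` from `v` has about `L (i + 1)` children, while `v` itself has about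
`M / (L 2 * ... * L r)` children. The cost, that is, minus the logarithm of the probability, is
about `log (L r) = L (r + 1)` for each vertex at distance `r`, and negligible on the other levels.

*Upper tail.* Breadth-first search from `v` is dominated by a branching process with Poisson
offspring of mean `d`, so the exponential moment of its size is at most the iterated exponential
`progenyBound`, see `bernoulliExp_pow_card_bfs_le`. At `x = (L r) ^ (1 - δ)` it is `n ^ o(1)` by
`eventually_mul_progenyBound_le`, while `x ^ ((1 + ε) * M) = n ^ ((1 - δ) * (1 + ε))`. Markov's
inequality and a union bound over `v` conclude.

*Lower tail.* The vertices are split into `r + 1` layers of about equal size, the heights, and only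
edges between consecutive heights are used. A vertex of height `j + 1` is fertile if it has at
least `b j` fertile neighbours of height `j`. Given the fertile vertices of height `j`, those of
height `j + 1` are independent, so their number is at least `n * exp (-extinctionCost C b j)` with
high probability (`bernoulliExp_card_fertile_lt_le`); for the thresholds `branching` the cost is
less than `log n` (`eventually_branching`), and there is a fertile vertex of height `r`. It starts
at least `(1 - ε / 2) * M` descending paths to height `0`. Their ends need not be distinct, but the
expected number of pairs of distinct descending paths with common ends is bounded
(`bernoulliExp_overlaps_le`), because the union of such a pair has at least as many edges as
vertices. As `M` tends to infinity, this loses at most `ε / 2 * M` neighbours with high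
probability.

Probabilities are finite sums throughout: `bernoulliExp` is the expectation over a binomial random
set of pairs, and `binomialRandom_eq_ofReal_bernoulliExp` identifies it with the random graph.
-/

/-! ### Expectations over a binomial random subset of a finite set -/

section BernoulliExp

open scoped Finset

variable {ι κ : Type*} {p : ℝ} {A B C : Finset ι} {f g : Finset ι → ℝ}

/-- The expectation of `f S`, where `S` is a random subset of the finite set `A` that contains each
element independently with probability `p`. The probability of an event is the expectation of its
`0`-`1`-valued indicator. -/
noncomputable def bernoulliExp (p : ℝ) (A : Finset ι) (f : Finset ι → ℝ) : ℝ :=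
  ∑ S ∈ A.powerset, p ^ #S * (1 - p) ^ (#A - #S) * f S

lemma bernoulliExp_mono (hp0 : 0 ≤ p) (hp1 : p ≤ 1) (h : ∀ S, f S ≤ g S) :
    bernoulliExp p A f ≤ bernoulliExp p A g := by
  have : 0 ≤ 1 - p := by linarith
  exact Finset.sum_le_sum fun S _ => mul_le_mul_of_nonneg_left (h S) (by positivity)

lemma bernoulliExp_congr (h : ∀ S ⊆ A, f S = g S) : bernoulliExp p A f = bernoulliExp p A g :=
  Finset.sum_congr rfl fun S hS => by rw [h S (Finset.mem_powerset.1 hS)]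

lemma bernoulliExp_const_mul (c : ℝ) :
    bernoulliExp p A (fun S => c * f S) = c * bernoulliExp p A f := by
  simp only [bernoulliExp, Finset.mul_sum]
  exact Finset.sum_congr rfl fun S _ => by ring

lemma bernoulliExp_mul_const (c : ℝ) :
    bernoulliExp p A (fun S => f S * c) = bernoulliExp p A f * c := by
  simp only [mul_comm _ c, bernoulliExp_const_mul]

lemma bernoulliExp_add :
    bernoulliExp p A (fun S => f S + g S) = bernoulliExp p A f + bernoulliExp p A g := by
  simp only [bernoulliExp, mul_add, Finset.sum_add_distrib]

lemma bernoulliExp_sum (s : Finset κ) (F : κ → Finset ι → ℝ) :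
    bernoulliExp p A (fun S => ∑ k ∈ s, F k S) = ∑ k ∈ s, bernoulliExp p A (F k) := by
  simp only [bernoulliExp, Finset.mul_sum]
  exact Finset.sum_comm

variable [DecidableEq ι]

/-- `f S` is determined by the part of `S` that lies in `B`. -/
def DeterminedOn {α : Type*} (B : Finset ι) (f : Finset ι → α) : Prop :=
  ∀ S, f (S ∩ B) = f S

lemma bernoulliExp_insert {a : ι} (ha : a ∉ A) :
    bernoulliExp p (insert a A) f =
      (1 - p) * bernoulliExp p A f + p * bernoulliExp p A (fun S => f (insert a S)) := by
  simp only [bernoulliExp, Finset.sum_powerset_insert ha, Finset.mul_sum]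
  congr 1
  · refine Finset.sum_congr rfl fun S hS => ?_
    have h := Finset.card_le_card (Finset.mem_powerset.1 hS)
    rw [Finset.card_insert_of_notMem ha, Nat.succ_sub h, pow_succ]
    ring
  · refine Finset.sum_congr rfl fun S hS => ?_
    have h := Finset.mem_powerset.1 hS
    rw [Finset.card_insert_of_notMem ha, Finset.card_insert_of_notMem (fun h' => ha (h h')),
      Nat.add_sub_add_right, pow_succ]
    ring

/-- Fubini: the parts of the random set in two disjoint sets are drawn one after the other. -/
lemma bernoulliExp_union (h : Disjoint A B) :
    bernoulliExp p (A ∪ B) f =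
      bernoulliExp p A (fun S => bernoulliExp p B (fun T => f (S ∪ T))) := by
  induction A using Finset.induction_on generalizing f with
  | empty => simp [bernoulliExp]
  | insert a A ha ih =>
    have h' := Finset.disjoint_insert_left.1 h
    rw [Finset.insert_union, bernoulliExp_insert (by simp [ha, h'.1]), bernoulliExp_insert ha,
      ih h'.2, ih h'.2]
    simp [Finset.insert_union]

@[simp] lemma bernoulliExp_const (c : ℝ) : bernoulliExp p A (fun _ => c) = c := by
  induction A using Finset.induction_on with
  | empty => simp [bernoulliExp]
  | insert a A ha ih => rw [bernoulliExp_insert ha, ih]; ring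

lemma bernoulliExp_nonneg (hp0 : 0 ≤ p) (hp1 : p ≤ 1) (h : ∀ S, 0 ≤ f S) :
    0 ≤ bernoulliExp p A f := by
  simpa using bernoulliExp_mono (A := A) (f := fun _ => 0) hp0 hp1 h

namespace DeterminedOn

lemma mono {α : Type*} {f : Finset ι → α} (hf : DeterminedOn B f) (h : B ⊆ C) :
    DeterminedOn C f := fun S => by
  rw [← hf, ← hf S, Finset.inter_assoc, Finset.inter_eq_right.2 h]

lemma comp {α β : Type*} {f : Finset ι → α} (hf : DeterminedOn B f) (g : α → β) :
    DeterminedOn B (fun S => g (f S)) := fun S => by simp only [hf S]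

lemma mul (hf : DeterminedOn B f) (hg : DeterminedOn B g) :
    DeterminedOn B (fun S => f S * g S) := fun S => by simp only [hf S, hg S]

lemma prod {s : Finset κ} {F : κ → Finset ι → ℝ} (h : ∀ k ∈ s, DeterminedOn B (F k)) :
    DeterminedOn B (fun S => ∏ k ∈ s, F k S) :=
  fun S => Finset.prod_congr rfl fun k hk => h k hk S

lemma indicator_mem {e : ι} (he : e ∈ B) :
    DeterminedOn B (fun S => if e ∈ S then (1 : ℝ) else 0) := fun S => by simp [he]

end DeterminedOn

/-- Independence: quantities determined on disjoint sets are uncorrelated. -/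
lemma bernoulliExp_mul (hf : DeterminedOn B f) (hg : DeterminedOn C g) (h : Disjoint B C) :
    bernoulliExp p A (fun S => f S * g S) = bernoulliExp p A f * bernoulliExp p A g := by
  have hd : Disjoint (A ∩ B) (A \ B) :=
    Finset.disjoint_sdiff.mono_left Finset.inter_subset_right
  have hA : A = A ∩ B ∪ A \ B := by grind
  have key : ∀ S ⊆ A ∩ B, ∀ T ⊆ A \ B, f (S ∪ T) = f S ∧ g (S ∪ T) = g T := by
    intro S hS T hT
    refine ⟨?_, ?_⟩
    · rw [← hf, ← hf S]; congr 1; grind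
    · rw [← hg, ← hg T]
      have := Finset.disjoint_left.1 h
      congr 1; grind
  rw [hA, bernoulliExp_union hd, bernoulliExp_union hd, bernoulliExp_union hd]
  have e1 : bernoulliExp p (A ∩ B) (fun S => bernoulliExp p (A \ B) fun T => f (S ∪ T)) =
      bernoulliExp p (A ∩ B) f := bernoulliExp_congr fun S hS => by
    rw [bernoulliExp_congr fun T hT => (key S hS T hT).1, bernoulliExp_const]
  have e2 : bernoulliExp p (A ∩ B) (fun S => bernoulliExp p (A \ B) fun T => g (S ∪ T)) =
      bernoulliExp p (A \ B) g := by
    rw [bernoulliExp_congr fun S hS => bernoulliExp_congr fun T hT => (key S hS T hT).2,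
      bernoulliExp_const]
  rw [e1, e2, ← bernoulliExp_mul_const]
  refine bernoulliExp_congr fun S hS => ?_
  rw [← bernoulliExp_const_mul]
  exact bernoulliExp_congr fun T hT => by rw [(key S hS T hT).1, (key S hS T hT).2]

lemma bernoulliExp_prod (s : Finset κ) (F : κ → Finset ι → ℝ) (D : κ → Finset ι)
    (hF : ∀ k ∈ s, DeterminedOn (D k) (F k))
    (hD : ∀ k ∈ s, ∀ l ∈ s, k ≠ l → Disjoint (D k) (D l)) :
    bernoulliExp p A (fun S => ∏ k ∈ s, F k S) = ∏ k ∈ s, bernoulliExp p A (F k) := by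
  classical
  induction s using Finset.induction_on with
  | empty => simp
  | insert a s ha ih =>
    simp only [Finset.prod_insert ha]
    rw [← ih (fun k hk => hF k (by simp [hk]))
      fun k hk l hl => hD k (by simp [hk]) l (by simp [hl])]
    refine bernoulliExp_mul (C := s.biUnion D) (hF a (by simp)) (DeterminedOn.prod fun k hk =>
      (hF k (by simp [hk])).mono (Finset.subset_biUnion_of_mem D hk)) ?_
    rw [Finset.disjoint_biUnion_right]
    exact fun k hk => hD a (by simp) k (by simp [hk]) (fun h => ha (h ▸ hk))

lemma bernoulliExp_eq_of_determinedOn (hf : DeterminedOn B f) (h : B ⊆ A) :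
    bernoulliExp p A f = bernoulliExp p B f := by
  have hA : A = B ∪ A \ B := by grind
  rw [hA, bernoulliExp_union Finset.disjoint_sdiff]
  refine bernoulliExp_congr fun S hS => ?_
  rw [bernoulliExp_congr (g := fun _ => f S), bernoulliExp_const]
  intro T hT
  rw [← hf]; congr 1; grind

lemma bernoulliExp_indicator_mem {e : ι} (he : e ∈ A) :
    bernoulliExp p A (fun S => if e ∈ S then 1 else 0) = p := by
  rw [bernoulliExp_eq_of_determinedOn (B := {e}) (DeterminedOn.indicator_mem (by simp))
    (by simpa using he)]
  rw [← insert_empty_eq, bernoulliExp_insert (by simp)]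
  simp [bernoulliExp]

open Classical in
omit [DecidableEq ι] in
lemma bernoulliExp_markov (hp0 : 0 ≤ p) (hp1 : p ≤ 1) {t : ℝ} (ht : 0 < t) (hf : ∀ S, 0 ≤ f S) :
    bernoulliExp p A (fun S => if t ≤ f S then 1 else 0) ≤ bernoulliExp p A f / t := by
  rw [div_eq_mul_inv, ← bernoulliExp_mul_const]
  refine bernoulliExp_mono hp0 hp1 fun S => ?_
  rw [← div_eq_mul_inv]
  split_ifs with h
  · rwa [one_le_div ht]
  · exact div_nonneg (hf S) ht.le

end BernoulliExp

/-! ### Breadth-first search and the exponential moment of its size -/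

section BreadthFirstSearch

open scoped Finset

variable {V : Type*} [DecidableEq V] {p d x : ℝ} {S T U : Finset V} {ω : Finset (Sym2 V)}

/-- The pairs with one entry in `X` and the other in `Y`. -/
def edgesBetween (X Y : Finset V) : Finset (Sym2 V) :=
  (X ×ˢ Y).image fun q => s(q.1, q.2)

/-- The unordered pairs of distinct vertices, that is, the potential edges. A graph is encoded by
its set of edges, a subset of `vertexPairs V`. -/
def vertexPairs (V : Type*) [Fintype V] [DecidableEq V] : Finset (Sym2 V) :=
  Finset.univ.filter fun e => ¬ e.IsDiag

lemma mk_mem_edgesBetween {u w : V} (hu : u ∈ S) (hw : w ∈ T) : s(u, w) ∈ edgesBetween S T :=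
  Finset.mem_image.2 ⟨(u, w), by simp [hu, hw], rfl⟩

/-- The vertices of `U` that are joined to `S` by an edge of `ω`. -/
def nbrsIn (ω : Finset (Sym2 V)) (S U : Finset V) : Finset V :=
  U.filter fun u => ∃ s ∈ S, s(s, u) ∈ ω

/-- The vertices found in the first `r` rounds of a breadth-first search that starts from the
sources `S` and looks for vertices in `U` only. The vertices found in a round are the sources of
the next round, and are removed from `U`. -/
def bfs (ω : Finset (Sym2 V)) : ℕ → Finset V → Finset V → Finset V
  | 0, _, _ => ∅
  | r + 1, S, U => nbrsIn ω S U ∪ bfs ω r (nbrsIn ω S U) (U \ nbrsIn ω S U)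

/-- An upper bound for the probability generating function, at `x`, of the number of descendants
through `r` generations in a branching process with Poisson offspring of mean `d`. The exact
recursion has `x * progenyBound d x r - 1` in place of `x * progenyBound d x r`. -/
noncomputable def progenyBound (d x : ℝ) : ℕ → ℝ
  | 0 => 1
  | r + 1 => Real.exp (d * (x * progenyBound d x r))

lemma nbrsIn_subset : nbrsIn ω S U ⊆ U := Finset.filter_subset _ _

lemma determinedOn_nbrsIn : DeterminedOn (edgesBetween S U) (fun ω => nbrsIn ω S U) := by
  intro ω
  refine Finset.filter_congr fun u hu => ?_
  refine exists_congr fun s => and_congr_right fun hs => ?_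
  simp [mk_mem_edgesBetween hs hu]

lemma determinedOn_bfs (r : ℕ) (S U : Finset V) :
    DeterminedOn (edgesBetween (S ∪ U) U) (fun ω => bfs ω r S U) := by
  induction r generalizing S U with
  | zero => intro ω; rfl
  | succ r ih =>
    intro ω
    have h1 : nbrsIn (ω ∩ edgesBetween (S ∪ U) U) S U = nbrsIn ω S U :=
      (determinedOn_nbrsIn.mono (Finset.image_subset_image
        (Finset.product_subset_product Finset.subset_union_left subset_rfl))) ω
    simp only [bfs, h1]
    congr 1
    have hT : nbrsIn ω S U ⊆ U := nbrsIn_subset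
    refine ((ih _ _).mono (Finset.image_subset_image
      (Finset.product_subset_product ?_ Finset.sdiff_subset))) ω
    grind

lemma disjoint_edgesBetween_of_disjoint (h : Disjoint S U) (hT : T ⊆ U) :
    Disjoint (edgesBetween S U) (edgesBetween (T ∪ (U \ T)) (U \ T)) := by
  have := Finset.disjoint_left.1 h
  rw [Finset.disjoint_left]
  intro e he he'
  simp only [edgesBetween, Finset.mem_image, Finset.mem_product, Prod.exists] at he he'
  obtain ⟨a, b, hab, rfl⟩ := he
  obtain ⟨a', b', hab', h⟩ := he'
  rw [Sym2.eq_iff] at h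
  grind

lemma one_le_progenyBound (hd : 0 ≤ d) (hx : 0 ≤ x) (r : ℕ) : 1 ≤ progenyBound d x r := by
  induction r with
  | zero => exact le_rfl
  | succ r ih => exact Real.one_le_exp (by positivity)

variable [Fintype V]

lemma bernoulliExp_pow_card_nbrsIn_le (hp0 : 0 ≤ p) (hp1 : p ≤ 1) (hd : 0 ≤ d) (h : Disjoint S U)
    (hU : #U * p ≤ d) {y : ℝ} (hy : 1 ≤ y) :
    bernoulliExp p (vertexPairs V) (fun ω => y ^ #(nbrsIn ω S U)) ≤ Real.exp (d * y) ^ #S := by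
  have hdis := Finset.disjoint_left.1 h
  have step1 : ∀ ω : Finset (Sym2 V), y ^ #(nbrsIn ω S U) ≤
      ∏ q ∈ S ×ˢ U, (1 + (y - 1) * if s(q.1, q.2) ∈ ω then 1 else 0) := by
    intro ω
    rw [Finset.prod_product_right, nbrsIn, Finset.card_filter, ← Finset.prod_pow_eq_pow_sum]
    refine Finset.prod_le_prod (fun _ _ => by positivity) fun u hu => ?_
    have h1 : ∀ s ∈ S, (1 : ℝ) ≤ 1 + (y - 1) * if s(s, u) ∈ ω then 1 else 0 := by
      intro s _; split_ifs <;> linarith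
    split_ifs with hs
    · obtain ⟨s, hs, hsu⟩ := hs
      rw [← Finset.mul_prod_erase _ _ hs, if_pos hsu]
      have := Finset.one_le_prod (s := S.erase s) fun i hi => h1 i (Finset.mem_of_mem_erase hi)
      nlinarith
    · simpa using Finset.one_le_prod h1
  refine (bernoulliExp_mono hp0 hp1 step1).trans ?_
  rw [bernoulliExp_prod _ _ (fun q => {s(q.1, q.2)})]
  · have : ∀ q ∈ S ×ˢ U, bernoulliExp p (vertexPairs V)
        (fun ω => 1 + (y - 1) * if s(q.1, q.2) ∈ ω then 1 else 0) = 1 + (y - 1) * p := by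
      intro q hq
      rw [bernoulliExp_add, bernoulliExp_const, bernoulliExp_const_mul, bernoulliExp_indicator_mem]
      simp only [vertexPairs, Finset.mem_filter, Finset.mem_univ, Sym2.mk_isDiag_iff, true_and]
      simp only [Finset.mem_product] at hq
      exact fun h' => hdis hq.1 (h' ▸ hq.2)
    rw [Finset.prod_congr rfl this, Finset.prod_const, Finset.card_product]
    have hy' : 0 ≤ (y - 1) * p := mul_nonneg (by linarith) hp0
    calc (1 + (y - 1) * p) ^ (#S * #U) ≤ Real.exp ((y - 1) * p) ^ (#S * #U) := by
          gcongr; rw [add_comm]; exact Real.add_one_le_exp _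
      _ = Real.exp (#U * p * (y - 1)) ^ #S := by
          rw [mul_comm (#S), pow_mul, ← Real.exp_nat_mul]; congr 2; ring
      _ ≤ _ := by
          gcongr
          nlinarith
  · intro q _
    exact (DeterminedOn.indicator_mem (by simp)).comp (fun t => 1 + (y - 1) * t)
  · intro q hq q' hq' hne
    simp only [Finset.mem_product] at hq hq'
    simp only [Finset.disjoint_singleton, ne_eq, Sym2.eq_iff]
    have := @hdis q.1
    have := @hdis q.2
    rintro (h | h)
    · exact hne (Prod.ext h.1 h.2)
    · grind

/-- The exponential moment of the search is dominated by that of a branching process: the vertices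
found in the first round depend on the pairs between `S` and `U` only, and given these vertices
the rest of the search uses pairs inside `U`. -/
lemma bernoulliExp_pow_card_bfs_le (hp0 : 0 ≤ p) (hp1 : p ≤ 1) (hd : 0 ≤ d) (hx : 1 ≤ x) (r : ℕ)
    (S U : Finset V) (h : Disjoint S U) (hU : #U * p ≤ d) :
    bernoulliExp p (vertexPairs V) (fun ω => x ^ #(bfs ω r S U)) ≤ progenyBound d x r ^ #S := by
  induction r generalizing S U with
  | zero => simp [bfs, progenyBound]
  | succ r ih =>
    have hx0 : 0 ≤ x := by linarith
    have hg := one_le_progenyBound hd hx0 r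
    have step1 : ∀ ω : Finset (Sym2 V), x ^ #(bfs ω (r + 1) S U) ≤ ∑ T ∈ U.powerset,
        (if nbrsIn ω S U = T then 1 else 0) * (x ^ #T * x ^ #(bfs ω r T (U \ T))) := by
      intro ω
      rw [Finset.sum_eq_single (nbrsIn ω S U)]
      · rw [if_pos rfl, one_mul, ← pow_add]
        exact pow_le_pow_right₀ hx (Finset.card_union_le _ _)
      · intro T _ hT
        rw [if_neg hT.symm, zero_mul]
      · intro h'
        exact absurd (Finset.mem_powerset.2 nbrsIn_subset) h'
    refine (bernoulliExp_mono hp0 hp1 step1).trans ?_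
    rw [bernoulliExp_sum]
    have step2 : ∀ T ∈ U.powerset, bernoulliExp p (vertexPairs V) (fun ω =>
        (if nbrsIn ω S U = T then 1 else 0) * (x ^ #T * x ^ #(bfs ω r T (U \ T)))) ≤
        bernoulliExp p (vertexPairs V) (fun ω =>
          (if nbrsIn ω S U = T then 1 else 0) * (x * progenyBound d x r) ^ #(nbrsIn ω S U)) := by
      intro T hT
      have hT := Finset.mem_powerset.1 hT
      have e1 : ∀ ω : Finset (Sym2 V),
          (if nbrsIn ω S U = T then (1 : ℝ) else 0) *
            (x * progenyBound d x r) ^ #(nbrsIn ω S U) =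
          (if nbrsIn ω S U = T then 1 else 0) * (x * progenyBound d x r) ^ #T := by
        intro ω; split_ifs with h'
        · rw [h']
        · simp
      simp only [e1]
      rw [bernoulliExp_mul_const, bernoulliExp_mul (B := edgesBetween S U)
        (C := edgesBetween (T ∪ (U \ T)) (U \ T))
        (f := fun ω => if nbrsIn ω S U = T then 1 else 0)
        (g := fun ω => x ^ #T * x ^ #(bfs ω r T (U \ T)))]
      · refine mul_le_mul_of_nonneg_left ?_
          (bernoulliExp_nonneg hp0 hp1 fun ω => by split_ifs <;> simp)
        rw [bernoulliExp_const_mul, mul_pow]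
        refine mul_le_mul_of_nonneg_left (ih T (U \ T) Finset.disjoint_sdiff ?_) (by positivity)
        refine le_trans ?_ hU
        gcongr
        exact Finset.sdiff_subset
      · exact determinedOn_nbrsIn.comp fun X => if X = T then (1 : ℝ) else 0
      · exact (determinedOn_bfs r T (U \ T)).comp fun X => x ^ #T * x ^ #X
      · exact disjoint_edgesBetween_of_disjoint h hT
    refine (Finset.sum_le_sum step2).trans ?_
    rw [← bernoulliExp_sum]
    have e2 : ∀ ω : Finset (Sym2 V), ∑ T ∈ U.powerset,
        (if nbrsIn ω S U = T then (1 : ℝ) else 0) * (x * progenyBound d x r) ^ #(nbrsIn ω S U) =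
        (x * progenyBound d x r) ^ #(nbrsIn ω S U) := by
      intro ω
      rw [← Finset.sum_mul, Finset.sum_ite_eq, if_pos (Finset.mem_powerset.2 nbrsIn_subset),
        one_mul]
    simp only [e2]
    exact bernoulliExp_pow_card_nbrsIn_le hp0 hp1 hd h hU (one_le_mul_of_one_le_of_one_le hx hg)

omit [Fintype V] [DecidableEq V] in
/-- Cut a walk at its last vertex outside `U`. -/
lemma SimpleGraph.Walk.exists_tail_subset {G : SimpleGraph V} {U : Set V} {x u : V}
    (w : G.Walk x u) (hu : u ∈ U) :
    (∀ z ∈ w.support, z ∈ U) ∨ ∃ s ∈ w.support, s ∉ U ∧ ∃ s', G.Adj s s' ∧ ∃ w' : G.Walk s' u,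
      (∀ z ∈ w'.support, z ∈ U) ∧ w'.length < w.length := by
  induction w with
  | nil => left; simpa using hu
  | @cons a b c hab w ih =>
    rcases ih hu with h | ⟨s, hs, hsU, s', hss', w', hw', hl⟩
    · by_cases ha : a ∈ U
      · left; simpa [ha] using h
      · right
        exact ⟨a, by simp, ha, b, hab, w, h, by simp⟩
    · right
      exact ⟨s, by simp [hs], hsU, s', hss', w', hw', hl.trans (by simp)⟩

omit [Fintype V] in
lemma mem_bfs_of_walk {r : ℕ} {s u : V} {G : SimpleGraph V} (hG : ∀ a b, G.Adj a b → s(a, b) ∈ ω)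
    (h : Disjoint S U) (hs : s ∈ S) (hu : u ∈ U) (w : G.Walk s u)
    (hw : ∀ z ∈ w.support, z ∈ S ∪ U) (hl : w.length ≤ r) : u ∈ bfs ω r S U := by
  have hdis := Finset.disjoint_left.1 h
  induction r generalizing S U s with
  | zero =>
    have := SimpleGraph.Walk.eq_of_length_eq_zero (Nat.le_zero.1 hl)
    exact absurd (this ▸ hu) (hdis hs)
  | succ r ih =>
    rcases w.exists_tail_subset (U := (U : Set V)) (by simpa using hu) with
      h' | ⟨a, ha, haU, b, hab, w', hw', hl'⟩
    · exact absurd (by simpa using h' s w.start_mem_support) (hdis hs)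
    · have haS : a ∈ S := by
        have := hw a ha
        simp only [Finset.mem_coe] at haU
        simpa [haU] using this
      have hb : b ∈ nbrsIn ω S U :=
        Finset.mem_filter.2 ⟨by simpa using hw' b w'.start_mem_support, a, haS, hG _ _ hab⟩
      rw [bfs, Finset.mem_union]
      by_cases huT : u ∈ nbrsIn ω S U
      · exact Or.inl huT
      · right
        refine ih (U := U \ nbrsIn ω S U) Finset.disjoint_sdiff hb (by simp [hu, huT]) w' ?_
          (by omega) (Finset.disjoint_left.1 Finset.disjoint_sdiff)
        intro z hz
        have := hw' z hz
        simp only [Finset.mem_coe] at this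
        simp only [Finset.mem_union, Finset.mem_sdiff]
        tauto

open Classical in
lemma degree_graphPower_le_card_bfs (r : ℕ) (v : V) :
    ((SimpleGraph.fromEdgeSet (ω : Set (Sym2 V))).graphPower r).degree v ≤
      #(bfs ω r {v} (Finset.univ.erase v)) := by
  rw [← SimpleGraph.card_neighborFinset_eq_degree]
  refine Finset.card_le_card fun u hu => ?_
  rw [SimpleGraph.mem_neighborFinset] at hu
  obtain ⟨hne, w, -, hl⟩ := hu
  refine mem_bfs_of_walk (s := v) (G := .fromEdgeSet (ω : Set (Sym2 V))) (fun a b hab => ?_)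
    (by simp) (by simp) (by simp [hne.symm]) w (fun z _ => ?_) hl
  · simpa using ((SimpleGraph.fromEdgeSet_adj _).1 hab).1
  · by_cases hz : z = v <;> simp [hz]

open Classical in
/-- Markov's inequality for the exponential moment, and a union bound over the vertices. -/
lemma bernoulliExp_lt_maxDegreePower_le [Nonempty V] (hp0 : 0 ≤ p) (hp1 : p ≤ 1) (hd : 0 ≤ d)
    (hV : Fintype.card V * p ≤ d) (hx : 1 ≤ x) (r : ℕ) (k : ℝ) :
    bernoulliExp p (vertexPairs V) (fun ω =>
      if k < ((SimpleGraph.fromEdgeSet (ω : Set (Sym2 V))).maxDegreePower r : ℝ) then 1 else 0) ≤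
      Fintype.card V * progenyBound d x r * x ^ (-k) := by
  have hx0 : 0 < x := by linarith
  have step1 : ∀ ω : Finset (Sym2 V),
      (if k < ((SimpleGraph.fromEdgeSet (ω : Set (Sym2 V))).maxDegreePower r : ℝ)
        then (1 : ℝ) else 0) ≤
      ∑ v : V, x ^ #(bfs ω r {v} (Finset.univ.erase v)) * x ^ (-k) := by
    intro ω
    have hnn : ∀ v ∈ Finset.univ,
        0 ≤ x ^ #(bfs ω r {v} (Finset.univ.erase v)) * x ^ (-k) := fun v _ => by positivity
    split_ifs with hk
    · obtain ⟨v, hv⟩ := SimpleGraph.exists_maximal_degree_vertex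
        ((SimpleGraph.fromEdgeSet (ω : Set (Sym2 V))).graphPower r)
      refine le_trans ?_ (Finset.single_le_sum hnn (Finset.mem_univ v))
      rw [← Real.rpow_natCast, ← Real.rpow_add hx0]
      refine Real.one_le_rpow hx ?_
      have h1 := degree_graphPower_le_card_bfs (ω := ω) r v
      rw [← hv] at h1
      have h2 : ((SimpleGraph.fromEdgeSet (ω : Set (Sym2 V))).maxDegreePower r : ℝ) ≤
        #(bfs ω r {v} (Finset.univ.erase v)) := by exact_mod_cast h1
      linarith
    · exact Finset.sum_nonneg hnn
  refine (bernoulliExp_mono hp0 hp1 step1).trans ?_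
  rw [bernoulliExp_sum]
  have step2 : ∀ v ∈ (Finset.univ : Finset V), bernoulliExp p (vertexPairs V) (fun ω =>
      x ^ #(bfs ω r {v} (Finset.univ.erase v)) * x ^ (-k)) ≤ progenyBound d x r * x ^ (-k) := by
    intro v _
    rw [bernoulliExp_mul_const]
    gcongr
    have := bernoulliExp_pow_card_bfs_le (d := d) hp0 hp1 hd hx r {v} (Finset.univ.erase v)
      (by simp) (le_trans (by gcongr; exact Finset.card_le_univ _) hV)
    simpa using this
  refine (Finset.sum_le_sum step2).trans ?_
  rw [Finset.sum_const, Finset.card_univ, nsmul_eq_mul, mul_assoc]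

end BreadthFirstSearch

/-! ### Fertile vertices in a layered graph -/

section Fertile

open scoped Finset

variable {V : Type*} [Fintype V] [DecidableEq V] {p d β : ℝ} {c : V → ℕ} {b : ℕ → ℕ}
  {ω : Finset (Sym2 V)}

/-- The vertices of height `i`, where `c` assigns a height to each vertex. -/
def layer (c : V → ℕ) (i : ℕ) : Finset V := Finset.univ.filter fun u => c u = i

/-- The pairs of vertices of height at most `j`. -/
def pairsUpTo (c : V → ℕ) (j : ℕ) : Finset (Sym2 V) :=
  edgesBetween (Finset.univ.filter fun u => c u ≤ j) (Finset.univ.filter fun u => c u ≤ j)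

/-- The fertile vertices of height `j`: every vertex of height `0` is fertile, and a vertex of
height `j + 1` is fertile if it has at least `b j` fertile neighbours of height `j`. -/
def fertile (ω : Finset (Sym2 V)) (c : V → ℕ) (b : ℕ → ℕ) : ℕ → Finset V
  | 0 => layer c 0
  | j + 1 => (layer c (j + 1)).filter fun u =>
      b j ≤ #((fertile ω c b j).filter fun w => s(u, w) ∈ ω)

omit [DecidableEq V] in
@[simp] lemma mem_layer {i : ℕ} {u : V} : u ∈ layer c i ↔ c u = i := by simp [layer]

lemma fertile_subset_layer (j : ℕ) : fertile ω c b j ⊆ layer c j := by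
  cases j
  · exact subset_rfl
  · exact Finset.filter_subset _ _

lemma mem_pairsUpTo {j : ℕ} {u w : V} : s(u, w) ∈ pairsUpTo c j ↔ c u ≤ j ∧ c w ≤ j := by
  simp only [pairsUpTo, edgesBetween, Finset.mem_image, Finset.mem_product, Finset.mem_filter,
    Finset.mem_univ, true_and, Prod.exists, Sym2.eq_iff]
  grind

lemma pairsUpTo_mono {i j : ℕ} (h : i ≤ j) : pairsUpTo c i ⊆ pairsUpTo c j := by
  intro e
  induction e using Sym2.ind with
  | _ u w => simp only [mem_pairsUpTo]; omega

lemma mk_mem_vertexPairs {u w : V} (h : u ≠ w) : s(u, w) ∈ vertexPairs V := by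
  simp [vertexPairs, h]

lemma determinedOn_fertile (j : ℕ) : DeterminedOn (pairsUpTo c j) (fun ω => fertile ω c b j) := by
  induction j with
  | zero => intro ω; rfl
  | succ j ih =>
    intro ω
    have h1 : fertile (ω ∩ pairsUpTo c (j + 1)) c b j = fertile ω c b j :=
      (ih.mono (pairsUpTo_mono j.le_succ)) ω
    simp only [fertile, h1]
    refine Finset.filter_congr fun u hu => ?_
    have h2 : ((fertile ω c b j).filter fun w => s(u, w) ∈ ω ∩ pairsUpTo c (j + 1)) =
        (fertile ω c b j).filter fun w => s(u, w) ∈ ω := Finset.filter_congr fun w hw => by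
      have hw := mem_layer.1 (fertile_subset_layer j hw)
      have hu := mem_layer.1 hu
      simp [mem_pairsUpTo, hu, hw]
    rw [h2]

lemma bernoulliExp_le_card_nbrs_ge (hp0 : 0 ≤ p) (hp1 : p ≤ 1) {u : V} {Γ : Finset V} (hu : u ∉ Γ)
    (k : ℕ) :
    (#Γ).choose k * p ^ k * (1 - p) ^ (#Γ - k) ≤ bernoulliExp p (vertexPairs V)
      (fun ω => if k ≤ #(Γ.filter fun w => s(u, w) ∈ ω) then 1 else 0) := by
  have hp1' : 0 ≤ 1 - p := by linarith
  have hinj : Function.Injective fun w : V => s(u, w) := fun w w' h => by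
    rcases Sym2.eq_iff.1 h with h | h <;> grind
  have hcard : #(Γ.image fun w => s(u, w)) = #Γ := Finset.card_image_of_injective _ hinj
  rw [bernoulliExp_eq_of_determinedOn (B := Γ.image fun w => s(u, w))]
  · have h1 : ∀ S ∈ (Γ.image fun w => s(u, w)).powersetCard k,
        p ^ k * (1 - p) ^ (#Γ - k) = p ^ #S * (1 - p) ^ (#(Γ.image fun w => s(u, w)) - #S) *
          if k ≤ #(Γ.filter fun w => s(u, w) ∈ S) then 1 else 0 := by
      intro S hS
      obtain ⟨hS, hk⟩ := Finset.mem_powersetCard.1 hS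
      have : (Γ.filter fun w => s(u, w) ∈ S).image (fun w => s(u, w)) = S := by
        ext e
        simp only [Finset.mem_image, Finset.mem_filter]
        constructor
        · rintro ⟨w, ⟨-, h⟩, rfl⟩; exact h
        · intro he
          obtain ⟨w, hw, rfl⟩ := Finset.mem_image.1 (hS he)
          exact ⟨w, ⟨hw, he⟩, rfl⟩
      have hc : #(Γ.filter fun w => s(u, w) ∈ S) = k := by
        rw [← hk, ← congrArg Finset.card this, Finset.card_image_of_injective _ hinj]
      rw [hc, if_pos le_rfl, mul_one, hcard, hk]
    have h2 : ((#Γ).choose k : ℝ) * p ^ k * (1 - p) ^ (#Γ - k) =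
        ∑ S ∈ (Γ.image fun w => s(u, w)).powersetCard k, p ^ k * (1 - p) ^ (#Γ - k) := by
      rw [Finset.sum_const, Finset.card_powersetCard, hcard, nsmul_eq_mul, mul_assoc]
    rw [h2, Finset.sum_congr rfl h1]
    refine Finset.sum_le_sum_of_subset_of_nonneg
      (fun S hS => Finset.mem_powerset.2 (Finset.mem_powersetCard.1 hS).1) fun S _ _ => ?_
    split_ifs <;> positivity
  · intro ω
    have : (Γ.filter fun w => s(u, w) ∈ ω ∩ Γ.image fun w => s(u, w)) =
        Γ.filter fun w => s(u, w) ∈ ω :=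
      Finset.filter_congr fun w hw => by
        simp only [Finset.mem_inter, and_iff_left_iff_imp]
        exact fun _ => Finset.mem_image_of_mem _ hw
    simp only [this]
  · intro e he
    obtain ⟨w, hw, rfl⟩ := Finset.mem_image.1 he
    exact mk_mem_vertexPairs fun h => hu (h ▸ hw)

/-- A crude lower bound for the probability that a binomial random variable with `h ≤ n` trials and
success probability `d / n` equals `k`, where `h ≥ n * exp (-K)`. -/
lemma exp_neg_le_choose_mul (hd : 0 < d) {n h k : ℕ} (hn : 2 * d ≤ n) (hk : 1 ≤ k) (hkh : 2 * k ≤ h)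
    (hh : h ≤ n) {K : ℝ} (hK : n * Real.exp (-K) ≤ h) :
    Real.exp (-(k * (K + Real.log k + Real.log (2 / d)) + 2 * d)) ≤
      h.choose k * (d / n) ^ k * (1 - d / n) ^ (h - k) := by
  have hn0 : (0 : ℝ) < n := by linarith
  have hk0 : (0 : ℝ) < k := by exact_mod_cast hk
  have hkh' : (2 * k : ℝ) ≤ h := by exact_mod_cast hkh
  have hpn : d / n ≤ 1 / 2 := by rw [div_le_iff₀ hn0]; linarith
  have hp0 : 0 < d / n := by positivity
  have h1 : ((h : ℝ) / (2 * k)) ^ k ≤ h.choose k := by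
    refine le_trans ?_ (Nat.pow_le_choose k h)
    rw [← div_div, div_pow]
    have h3 : ((Nat.factorial k : ℕ) : ℝ) ≤ (k : ℝ) ^ k := by exact_mod_cast k.factorial_le_pow
    have h4 : (h : ℝ) / 2 ≤ ((h + 1 - k : ℕ) : ℝ) := by
      rw [Nat.cast_sub (by omega)]
      push_cast
      linarith
    have h5 : (0 : ℝ) < (Nat.factorial k : ℕ) := by exact_mod_cast k.factorial_pos
    gcongr
  have h2 : Real.exp (-(2 * d)) ≤ (1 - d / n) ^ (h - k) := by
    have e1 : Real.exp (-(2 * (d / n))) ≤ 1 - d / n := by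
      rw [Real.exp_neg, inv_le_comm₀ (Real.exp_pos _) (by linarith)]
      refine le_trans ?_ (Real.add_one_le_exp _)
      rw [inv_le_iff_one_le_mul₀ (by linarith)]
      nlinarith
    calc Real.exp (-(2 * d)) = Real.exp (-(2 * (d / n))) ^ n := by
          rw [← Real.exp_nat_mul]; congr 1; field_simp
      _ ≤ (1 - d / n) ^ n := by gcongr
      _ ≤ _ := pow_le_pow_of_le_one (by linarith) (by linarith) (by omega)
  have h3 : Real.exp (-(k * (K + Real.log k + Real.log (2 / d)))) ≤
      ((h : ℝ) / (2 * k)) ^ k * (d / n) ^ k := by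
    rw [← mul_pow, ← mul_neg, Real.exp_nat_mul]
    refine pow_le_pow_left₀ (Real.exp_pos _).le ?_ k
    rw [neg_add, neg_add, Real.exp_add, Real.exp_add, Real.exp_neg (Real.log _),
      Real.exp_neg (Real.log _), Real.exp_log hk0, Real.exp_log (by positivity)]
    calc Real.exp (-K) * (k : ℝ)⁻¹ * (2 / d)⁻¹ = (n * Real.exp (-K)) / (2 * k) * (d / n) := by
          field_simp
      _ ≤ _ := by gcongr
  rw [neg_add, Real.exp_add]
  refine mul_le_mul (h3.trans ?_) h2 (Real.exp_pos _).le (by positivity)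
  gcongr

/-- `n * exp (-extinctionCost C b j)` is a lower bound, with high probability, for the number of
fertile vertices of height `j` among `n` vertices. The constant `C` absorbs the dependence on `d`
and on the relative sizes of the layers. -/
noncomputable def extinctionCost (C : ℝ) (b : ℕ → ℕ) : ℕ → ℝ
  | 0 => C
  | j + 1 => b j * (extinctionCost C b j + Real.log (b j) + C)

/-- Given the fertile vertices of height `j`, the vertices of height `j + 1` are fertile
independently of each other, because their stars are disjoint. -/
lemma bernoulliExp_half_pow_card_fertile_le (hp0 : 0 ≤ p) (hp1 : p ≤ 1) {j : ℕ} {m q : ℝ}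
    (hq : ∀ Γ ⊆ layer c j, m ≤ #Γ → ∀ u ∈ layer c (j + 1), q ≤ bernoulliExp p (vertexPairs V)
      (fun ω => if b j ≤ #(Γ.filter fun w => s(u, w) ∈ ω) then 1 else 0)) :
    bernoulliExp p (vertexPairs V) (fun ω => if m ≤ #(fertile ω c b j)
      then (1 / 2 : ℝ) ^ #(fertile ω c b (j + 1)) else 0) ≤
        Real.exp (-(#(layer c (j + 1)) * (q / 2))) := by
  set F : Finset V → V → Finset (Sym2 V) → ℝ := fun Γ u ω =>
    1 + (-(1 / 2)) * (if b j ≤ #(Γ.filter fun w => s(u, w) ∈ ω) then 1 else 0) with hF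
  set L := (layer c j).powerset.filter fun Γ => m ≤ #Γ with hL
  have e1 : ∀ ω : Finset (Sym2 V), (if m ≤ #(fertile ω c b j)
      then (1 / 2 : ℝ) ^ #(fertile ω c b (j + 1)) else 0) =
      ∑ Γ ∈ L, (if fertile ω c b j = Γ then 1 else 0) * ∏ u ∈ layer c (j + 1), F Γ u ω := by
    intro ω
    simp only [ite_mul, one_mul, zero_mul, Finset.sum_ite_eq]
    simp only [hL, Finset.mem_filter, Finset.mem_powerset, fertile_subset_layer, true_and]
    refine if_congr Iff.rfl ?_ rfl
    rw [fertile, Finset.card_filter, ← Finset.prod_pow_eq_pow_sum]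
    refine Finset.prod_congr rfl fun u _ => ?_
    simp only [hF]
    split_ifs <;> norm_num
  simp only [e1]
  rw [bernoulliExp_sum]
  have e2 : ∀ Γ ∈ L, bernoulliExp p (vertexPairs V) (fun ω =>
      (if fertile ω c b j = Γ then 1 else 0) * ∏ u ∈ layer c (j + 1), F Γ u ω) ≤
      bernoulliExp p (vertexPairs V) (fun ω => if fertile ω c b j = Γ then 1 else 0) *
        Real.exp (-(#(layer c (j + 1)) * (q / 2))) := by
    intro Γ hΓ
    simp only [hL, Finset.mem_filter, Finset.mem_powerset] at hΓ
    have hdet : ∀ u ∈ layer c (j + 1), DeterminedOn (edgesBetween {u} Γ) (F Γ u) := by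
      intro u _ ω
      have : (Γ.filter fun w => s(u, w) ∈ ω ∩ edgesBetween {u} Γ) =
          Γ.filter fun w => s(u, w) ∈ ω :=
        Finset.filter_congr fun w hw => by simp [mk_mem_edgesBetween, hw]
      simp only [hF, this]
    rw [bernoulliExp_mul (f := fun ω => if fertile ω c b j = Γ then 1 else 0)
      (g := fun ω => ∏ u ∈ layer c (j + 1), F Γ u ω)
      ((determinedOn_fertile j).comp fun X => if X = Γ then (1 : ℝ) else 0)
      (C := edgesBetween (layer c (j + 1)) Γ)]
    · refine mul_le_mul_of_nonneg_left ?_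
        (bernoulliExp_nonneg hp0 hp1 fun ω => by split_ifs <;> simp)
      rw [bernoulliExp_prod _ _ (fun u => edgesBetween {u} Γ) hdet]
      · have : ∀ u ∈ layer c (j + 1),
            bernoulliExp p (vertexPairs V) (F Γ u) ≤ Real.exp (-(q / 2)) := by
          intro u hu
          simp only [hF]
          rw [bernoulliExp_add, bernoulliExp_const, bernoulliExp_const_mul]
          have := hq Γ hΓ.1 hΓ.2 u hu
          have := Real.add_one_le_exp (-(q / 2))
          linarith
        refine (Finset.prod_le_prod (fun u _ => bernoulliExp_nonneg hp0 hp1 fun ω => ?_) this).trans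
          ?_
        · simp only [hF]; split_ifs <;> norm_num
        · rw [Finset.prod_const, ← Real.exp_nat_mul, mul_neg]
      · intro u hu u' hu' hne
        rw [Finset.disjoint_left]
        intro e he he'
        simp only [edgesBetween, Finset.mem_image, Finset.mem_product, Prod.exists,
          Finset.mem_singleton] at he he'
        obtain ⟨x, y, ⟨rfl, hy⟩, rfl⟩ := he
        obtain ⟨x', y', ⟨rfl, hy'⟩, h⟩ := he'
        have hy := mem_layer.1 (hΓ.1 hy)
        have hy' := mem_layer.1 (hΓ.1 hy')
        rw [mem_layer] at hu hu'
        rcases Sym2.eq_iff.1 h with h | h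
        · exact hne h.1.symm
        · rw [h.2] at hy'; omega
    · exact DeterminedOn.prod fun u hu => (hdet u hu).mono (Finset.image_subset_image
        (Finset.product_subset_product (by simpa using hu) subset_rfl))
    · rw [Finset.disjoint_left]
      intro e he he'
      obtain ⟨⟨x, y⟩, hxy, rfl⟩ := Finset.mem_image.1 he'
      have := mem_pairsUpTo.1 he
      simp only [Finset.mem_product, mem_layer] at hxy
      dsimp only at this
      omega
  refine (Finset.sum_le_sum e2).trans ?_
  rw [← Finset.sum_mul, ← bernoulliExp_sum]
  refine mul_le_of_le_one_left (Real.exp_pos _).le ?_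
  rw [← bernoulliExp_const (p := p) (A := vertexPairs V) 1]
  refine bernoulliExp_mono hp0 hp1 fun ω => ?_
  rw [Finset.sum_ite_eq]
  split_ifs <;> simp

lemma bernoulliExp_card_fertile_lt_le (hd : 0 < d) {n r : ℕ} (hV : Fintype.card V = n)
    (hn : 2 * d ≤ n) (hβ : 0 < β) (hβ1 : β ≤ 1) (hc : ∀ j ≤ r, β * n ≤ #(layer c j)) {C : ℝ}
    (hC : |Real.log (2 / d)| + 2 * d + Real.log (4 / β) ≤ C)
    (hb1 : ∀ j < r, 1 ≤ b j) (hb2 : ∀ j < r, 2 * b j ≤ n * Real.exp (-extinctionCost C b j))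
    (j : ℕ) (hj : j ≤ r) :
    bernoulliExp (d / n) (vertexPairs V)
      (fun ω => if (#(fertile ω c b j) : ℝ) < n * Real.exp (-extinctionCost C b j) then 1 else 0) ≤
      ∑ i ∈ Finset.range j, Real.exp (-(n * Real.exp (-extinctionCost C b (i + 1)))) := by
  have hn0 : (0 : ℝ) < n := by linarith
  have hp0 : 0 ≤ d / n := by positivity
  have hp1 : d / n ≤ 1 := by rw [div_le_one hn0]; linarith
  have hl4 : 0 ≤ Real.log (4 / β) := Real.log_nonneg (by rw [le_div_iff₀ hβ]; linarith)
  have hexpC : Real.exp (-Real.log (4 / β)) = β / 4 := by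
    rw [Real.exp_neg, Real.exp_log (by positivity), inv_div]
  induction j with
  | zero =>
    have : ¬ ((#(layer c 0) : ℝ) < n * Real.exp (-C)) := by
      rw [not_lt]
      refine le_trans ?_ (hc 0 hj)
      rw [mul_comm]
      gcongr
      calc Real.exp (-C) ≤ Real.exp (-Real.log (4 / β)) := by
            have := abs_nonneg (Real.log (2 / d))
            gcongr; linarith
        _ ≤ β := by rw [hexpC]; linarith
    simp [fertile, extinctionCost, this]
  | succ j ih =>
    set K := extinctionCost C b j with hKdef
    set K' := extinctionCost C b (j + 1) with hK'def
    set q := Real.exp (-(b j * (K + Real.log (b j) + Real.log (2 / d)) + 2 * d)) with hq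
    have hbj : (1 : ℝ) ≤ b j := by exact_mod_cast hb1 j hj
    have hK' : Real.exp (-K') ≤ β / 4 * q := by
      rw [← hexpC, hq, ← Real.exp_add, Real.exp_le_exp, hK'def, extinctionCost, ← hKdef]
      have h1 := le_abs_self (Real.log (2 / d))
      have h2 : (b j : ℝ) * (Real.log (2 / d) + 2 * d + Real.log (4 / β)) ≤ b j * C := by
        gcongr; linarith
      nlinarith
    have hstep := bernoulliExp_half_pow_card_fertile_le (V := V) (c := c) (b := b) (j := j)
      (m := n * Real.exp (-K)) (q := q) hp0 hp1 fun Γ hΓ hm u hu => by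
        refine le_trans ?_ (bernoulliExp_le_card_nbrs_ge hp0 hp1 (fun h => ?_) (b j))
        · refine exp_neg_le_choose_mul hd hn (hb1 j hj) ?_ ?_ hm
          · have := (hb2 j hj).trans hm
            exact_mod_cast this
          · rw [← hV]; exact Finset.card_le_univ _
        · have h1 := mem_layer.1 (hΓ h)
          have h2 := mem_layer.1 hu
          omega
    rw [Finset.sum_range_succ]
    have hle : ∀ ω : Finset (Sym2 V),
        (if (#(fertile ω c b (j + 1)) : ℝ) < n * Real.exp (-K') then (1 : ℝ) else 0) ≤
        (if (#(fertile ω c b j) : ℝ) < n * Real.exp (-K) then 1 else 0) +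
        Real.exp (n * Real.exp (-K')) * (if n * Real.exp (-K) ≤ #(fertile ω c b j)
          then (1 / 2 : ℝ) ^ #(fertile ω c b (j + 1)) else 0) := by
      intro ω
      by_cases h1 : (#(fertile ω c b j) : ℝ) < n * Real.exp (-K)
      · rw [if_pos h1, if_neg h1.not_ge]
        split_ifs <;> norm_num
      · rw [if_neg h1, if_pos (not_lt.1 h1), zero_add]
        split_ifs with h2
        · rw [one_div, inv_pow, ← div_eq_mul_inv, one_le_div (by positivity)]
          calc (2 : ℝ) ^ #(fertile ω c b (j + 1)) ≤ Real.exp 1 ^ #(fertile ω c b (j + 1)) := by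
                gcongr
                have := Real.add_one_le_exp 1
                linarith
            _ ≤ _ := by
                rw [← Real.exp_nat_mul, mul_one]
                exact Real.exp_le_exp.2 h2.le
        · positivity
    refine (bernoulliExp_mono hp0 hp1 hle).trans ?_
    rw [bernoulliExp_add, bernoulliExp_const_mul]
    refine add_le_add (ih (by omega)) ?_
    refine (mul_le_mul_of_nonneg_left hstep (Real.exp_pos _).le).trans ?_
    rw [← Real.exp_add, Real.exp_le_exp]
    have h3 := hc (j + 1) hj
    have hq0 : 0 < q := Real.exp_pos _
    have h4 : n * Real.exp (-K') ≤ n * (β / 4 * q) := by gcongr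
    have h5 : β * n * (q / 2) ≤ #(layer c (j + 1)) * (q / 2) := by gcongr
    linarith

end Fertile

/-! ### Descending paths and their overlaps -/

section DescendingPaths

open scoped Finset

variable {V : Type*} [Fintype V] [DecidableEq V] {p d : ℝ} {c : V → ℕ} {b : ℕ → ℕ}
  {ω : Finset (Sym2 V)} {w : V}

/-- For `u` of height `j`, the number of paths in `ω` from `u` to the vertex `w` of height `0`
along which the height drops by one in every step. -/
def descents (ω : Finset (Sym2 V)) (c : V → ℕ) (w : V) : ℕ → V → ℕ
  | 0, u => if u = w then 1 else 0
  | j + 1, u => ∑ u' ∈ (layer c j).filter (fun u' => s(u, u') ∈ ω), descents ω c w j u'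

lemma prod_le_sum_descents {j : ℕ} {u : V} (hu : u ∈ fertile ω c b j) :
    ∏ i ∈ Finset.range j, b i ≤ ∑ w ∈ layer c 0, descents ω c w j u := by
  induction j generalizing u with
  | zero =>
    simp only [descents, Finset.sum_ite_eq, Finset.range_zero, Finset.prod_empty]
    rw [if_pos (by simpa [fertile] using hu)]
  | succ j ih =>
    have hu' : b j ≤ #((fertile ω c b j).filter fun w => s(u, w) ∈ ω) :=
      (Finset.mem_filter.1 hu).2
    simp only [descents]
    rw [Finset.sum_comm, Finset.prod_range_succ, mul_comm]
    calc b j * ∏ i ∈ Finset.range j, b i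
        ≤ #((fertile ω c b j).filter fun w => s(u, w) ∈ ω) * ∏ i ∈ Finset.range j, b i := by gcongr
      _ = ∑ u' ∈ (fertile ω c b j).filter fun w => s(u, w) ∈ ω, ∏ i ∈ Finset.range j, b i := by
          rw [Finset.sum_const, smul_eq_mul]
      _ ≤ ∑ u' ∈ (fertile ω c b j).filter fun w => s(u, w) ∈ ω,
          ∑ w ∈ layer c 0, descents ω c w j u' :=
          Finset.sum_le_sum fun u' hu' => ih (Finset.mem_filter.1 hu').1
      _ ≤ _ := Finset.sum_le_sum_of_subset
          (Finset.filter_subset_filter _ (fertile_subset_layer j))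

lemma exists_walk_of_descents_pos {j : ℕ} {u : V} (hu : u ∈ layer c j)
    (h : 0 < descents ω c w j u) :
    ∃ q : (SimpleGraph.fromEdgeSet (ω : Set (Sym2 V))).Walk u w, q.length = j := by
  induction j generalizing u with
  | zero =>
    have : u = w := by
      by_contra hne
      simp [descents, hne] at h
    subst this
    exact ⟨.nil, rfl⟩
  | succ j ih =>
    simp only [descents] at h
    obtain ⟨u', hu', hpos⟩ := Finset.exists_ne_zero_of_sum_ne_zero h.ne'
    obtain ⟨hl, he⟩ := Finset.mem_filter.1 hu'
    obtain ⟨q, hq⟩ := ih hl (Nat.pos_of_ne_zero hpos)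
    have hne : u ≠ u' := by
      rintro rfl
      have h1 := mem_layer.1 hl
      have h2 := mem_layer.1 hu
      omega
    exact ⟨.cons ((SimpleGraph.fromEdgeSet_adj _).2 ⟨by simpa using he, hne⟩) q, by simp [hq]⟩

/-- The number of ordered pairs of distinct descending paths from a common vertex of height `j` to
the vertex `w`. -/
noncomputable def overlaps (ω : Finset (Sym2 V)) (c : V → ℕ) (w : V) (j : ℕ) : ℝ :=
  ∑ u ∈ layer c j, ((descents ω c w j u : ℝ) ^ 2 - descents ω c w j u)

lemma natCast_le_sq (m : ℕ) : (m : ℝ) ≤ (m : ℝ) ^ 2 := by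
  exact_mod_cast Nat.le_self_pow two_ne_zero m

lemma overlaps_nonneg (j : ℕ) : 0 ≤ overlaps ω c w j :=
  Finset.sum_nonneg fun _ _ => sub_nonneg.2 (natCast_le_sq _)

open Classical in
/-- Distinct descending paths from `v` lead to distinct neighbours of `v` in the power graph, up to
an error counted by the overlaps. -/
lemma sum_descents_sub_overlaps_le_degree {r : ℕ} (hr : 1 ≤ r) {v : V} (hv : v ∈ layer c r) :
    ∑ w ∈ layer c 0, (descents ω c w r v : ℝ) - ∑ w ∈ layer c 0, overlaps ω c w r ≤
      ((SimpleGraph.fromEdgeSet (ω : Set (Sym2 V))).graphPower r).degree v := by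
  have h1 : #((layer c 0).filter fun w => 0 < descents ω c w r v) ≤
      ((SimpleGraph.fromEdgeSet (ω : Set (Sym2 V))).graphPower r).degree v := by
    rw [← SimpleGraph.card_neighborFinset_eq_degree]
    refine Finset.card_le_card fun w hw => ?_
    obtain ⟨hw0, hw⟩ := Finset.mem_filter.1 hw
    obtain ⟨q, hq⟩ := exists_walk_of_descents_pos hv hw
    rw [SimpleGraph.mem_neighborFinset]
    refine ⟨?_, q.bypass, q.bypass_isPath, q.length_bypass_le_length.trans hq.le⟩
    rintro rfl
    have h1 := mem_layer.1 hw0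
    have h2 := mem_layer.1 hv
    omega
  have h2 : ∑ w ∈ layer c 0, ((descents ω c w r v : ℝ) -
      ((descents ω c w r v : ℝ) ^ 2 - descents ω c w r v)) ≤
      #((layer c 0).filter fun w => 0 < descents ω c w r v) := by
    rw [Finset.card_filter]
    push_cast
    refine Finset.sum_le_sum fun w _ => ?_
    rcases Nat.eq_zero_or_pos (descents ω c w r v) with h | h
    · simp [h]
    · rw [if_pos h]
      nlinarith [sq_nonneg ((descents ω c w r v : ℝ) - 1)]
  have h3 : ∑ w ∈ layer c 0, ((descents ω c w r v : ℝ) ^ 2 - descents ω c w r v) ≤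
      ∑ w ∈ layer c 0, overlaps ω c w r :=
    Finset.sum_le_sum fun w _ => Finset.single_le_sum
      (f := fun v => (descents ω c w r v : ℝ) ^ 2 - descents ω c w r v)
      (fun _ _ => sub_nonneg.2 (natCast_le_sq _)) hv
  have h4 : (#((layer c 0).filter fun w => 0 < descents ω c w r v) : ℝ) ≤
      ((SimpleGraph.fromEdgeSet (ω : Set (Sym2 V))).graphPower r).degree v := by exact_mod_cast h1
  rw [Finset.sum_sub_distrib] at h2
  linarith

lemma determinedOn_descents (j : ℕ) {u : V} (hu : u ∈ layer c j) :
    DeterminedOn (pairsUpTo c j) (fun ω => (descents ω c w j u : ℝ)) := by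
  induction j generalizing u with
  | zero => intro ω; rfl
  | succ j ih =>
    intro ω
    simp only [descents, Finset.sum_filter]
    push_cast
    refine Finset.sum_congr rfl fun u' hu' => ?_
    have h1 : (descents (ω ∩ pairsUpTo c (j + 1)) c w j u' : ℝ) = descents ω c w j u' :=
      ((ih hu').mono (pairsUpTo_mono j.le_succ)) ω
    rw [h1]
    have hu := mem_layer.1 hu
    have hu' := mem_layer.1 hu'
    refine if_congr ?_ rfl rfl
    simp [mem_pairsUpTo, hu, hu']

lemma descents_succ (j : ℕ) (u : V) : (descents ω c w (j + 1) u : ℝ) =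
    ∑ u' ∈ layer c j, (if s(u, u') ∈ ω then 1 else 0) * (descents ω c w j u' : ℝ) := by
  simp only [descents, Finset.sum_filter]
  push_cast
  exact Finset.sum_congr rfl fun u' _ => by split_ifs <;> simp

/-- The expectation of a product of indicators of one or two edges between the heights `j` and
`j + 1` and of a quantity that depends on smaller heights only. -/
lemma bernoulliExp_two_edges_mul {j : ℕ} {u v u' v' : V} (hu : u ∈ layer c (j + 1))
    (hv : v ∈ layer c (j + 1)) (hu' : u' ∈ layer c j) (hv' : v' ∈ layer c j)
    {X : Finset (Sym2 V) → ℝ} (hX : DeterminedOn (pairsUpTo c j) X) :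
    bernoulliExp p (vertexPairs V) (fun ω =>
      ((if s(u, u') ∈ ω then 1 else 0) * (if s(v, v') ∈ ω then 1 else 0)) * X ω) =
      (if u = v ∧ u' = v' then p else p ^ 2) * bernoulliExp p (vertexPairs V) X := by
  rw [mem_layer] at hu hv hu' hv'
  have he : s(u, u') ∈ vertexPairs V := mk_mem_vertexPairs (by rintro rfl; omega)
  have hf : s(v, v') ∈ vertexPairs V := mk_mem_vertexPairs (by rintro rfl; omega)
  have hiff : s(u, u') = s(v, v') ↔ u = v ∧ u' = v' := by
    rw [Sym2.eq_iff]
    constructor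
    · rintro (h | h)
      · exact h
      · exfalso
        rw [h.1] at hu
        omega
    · exact Or.inl
  rw [bernoulliExp_mul (B := {s(u, u'), s(v, v')}) (C := pairsUpTo c j) (g := X)
    ((DeterminedOn.indicator_mem (by simp)).mul (DeterminedOn.indicator_mem (by simp))) hX]
  · congr 1
    split_ifs with h
    · obtain ⟨rfl, rfl⟩ := h
      refine Eq.trans (bernoulliExp_congr fun S _ => ?_) (bernoulliExp_indicator_mem he)
      split_ifs <;> simp
    · rw [bernoulliExp_mul (B := {s(u, u')}) (C := {s(v, v')})
        (DeterminedOn.indicator_mem (by simp)) (DeterminedOn.indicator_mem (by simp)),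
        bernoulliExp_indicator_mem he, bernoulliExp_indicator_mem hf, sq]
      simpa [hiff] using h
  · simp only [Finset.disjoint_insert_left, Finset.disjoint_singleton_left, mem_pairsUpTo]
    omega

lemma bernoulliExp_sq_sum_descents_le (hp0 : 0 ≤ p) (hp1 : p ≤ 1)
    (hV : Fintype.card V * p ≤ d) (w : V) (j : ℕ) :
    bernoulliExp p (vertexPairs V) (fun ω => (∑ u ∈ layer c j, (descents ω c w j u : ℝ)) ^ 2) ≤
      (1 + d + d ^ 2) ^ j := by
  have hd : 0 ≤ d := le_trans (mul_nonneg (Nat.cast_nonneg _) hp0) hV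
  induction j with
  | zero =>
    rw [pow_zero, ← bernoulliExp_const (p := p) (A := vertexPairs V) 1]
    refine bernoulliExp_mono hp0 hp1 fun ω => ?_
    simp only [descents, Nat.cast_ite, Nat.cast_one, Nat.cast_zero, Finset.sum_ite_eq']
    split_ifs <;> norm_num
  | succ j ih =>
    set n : ℝ := (Fintype.card V : ℝ) with hn
    have hcard : ∀ i, (#(layer c i) : ℝ) ≤ n := fun i =>
      Nat.cast_le.2 (Finset.card_le_univ (layer c i))
    set L := layer c j with hL
    set L' := layer c (j + 1) with hL'
    have e1 : ∀ ω : Finset (Sym2 V), (∑ u ∈ L', (descents ω c w (j + 1) u : ℝ)) ^ 2 =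
        ∑ u ∈ L', ∑ v ∈ L', ∑ u' ∈ L, ∑ v' ∈ L,
          ((if s(u, u') ∈ ω then 1 else 0) * (if s(v, v') ∈ ω then 1 else 0)) *
            ((descents ω c w j u' : ℝ) * descents ω c w j v') := by
      intro ω
      rw [sq, Finset.sum_mul_sum]
      refine Finset.sum_congr rfl fun u _ => Finset.sum_congr rfl fun v _ => ?_
      rw [descents_succ, descents_succ, Finset.sum_mul_sum]
      exact Finset.sum_congr rfl fun u' _ => Finset.sum_congr rfl fun v' _ => by ring
    simp only [e1, bernoulliExp_sum]
    have e2 : ∀ u ∈ L', ∀ v ∈ L', ∀ u' ∈ L, ∀ v' ∈ L, bernoulliExp p (vertexPairs V) (fun ω =>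
          ((if s(u, u') ∈ ω then 1 else 0) * (if s(v, v') ∈ ω then 1 else 0)) *
            ((descents ω c w j u' : ℝ) * descents ω c w j v')) ≤
        p ^ 2 * bernoulliExp p (vertexPairs V)
          (fun ω => (descents ω c w j u' : ℝ) * descents ω c w j v') +
        if u = v then (if u' = v' then p * bernoulliExp p (vertexPairs V)
          (fun ω => (descents ω c w j u' : ℝ) * descents ω c w j v') else 0) else 0 := by
      intro u hu v hv u' hu' v' hv'
      rw [bernoulliExp_two_edges_mul hu hv hu' hv'
        ((determinedOn_descents j hu').mul (determinedOn_descents j hv'))]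
      have h0 : 0 ≤ bernoulliExp p (vertexPairs V)
          (fun ω => (descents ω c w j u' : ℝ) * descents ω c w j v') :=
        bernoulliExp_nonneg hp0 hp1 fun ω => by positivity
      have hp2 : 0 ≤ p ^ 2 * bernoulliExp p (vertexPairs V)
          (fun ω => (descents ω c w j u' : ℝ) * descents ω c w j v') := by positivity
      by_cases h1 : u = v <;> by_cases h2 : u' = v' <;> simp only [h1, h2, and_self, and_true,
        and_false, if_true, if_false] <;> subst_vars <;> linarith
    refine (Finset.sum_le_sum fun u hu => Finset.sum_le_sum fun v hv => Finset.sum_le_sum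
      fun u' hu' => Finset.sum_le_sum fun v' hv' => e2 u hu v hv u' hu' v' hv').trans ?_
    set E : V → V → ℝ := fun u' v' => bernoulliExp p (vertexPairs V)
          (fun ω => (descents ω c w j u' : ℝ) * descents ω c w j v') with hE
    set Z := bernoulliExp p (vertexPairs V)
      (fun ω => (∑ u ∈ L, (descents ω c w j u : ℝ)) ^ 2) with hZ
    have hZ0 : 0 ≤ Z := bernoulliExp_nonneg hp0 hp1 fun ω => by positivity
    have hsum : ∑ u' ∈ L, ∑ v' ∈ L, E u' v' = Z := by
      simp only [hE, hZ, ← bernoulliExp_sum, sq, Finset.sum_mul_sum]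
    have hdiag : ∑ u' ∈ L, E u' u' ≤ Z := by
      rw [← hsum]
      refine Finset.sum_le_sum fun u' hu' => Finset.single_le_sum (f := fun v' => E u' v')
        (fun v' _ => bernoulliExp_nonneg hp0 hp1 fun ω => by positivity) hu'
    have e3 : ∑ u ∈ L', ∑ v ∈ L', ∑ u' ∈ L, ∑ v' ∈ L, (p ^ 2 * E u' v' +
        if u = v then (if u' = v' then p * E u' v' else 0) else 0) =
        (#L' * p) ^ 2 * Z + #L' * p * ∑ u' ∈ L, E u' u' := by
      have i1 : ∀ u ∈ L', ∀ v ∈ L', ∑ u' ∈ L, ∑ v' ∈ L, (p ^ 2 * E u' v' +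
        if u = v then (if u' = v' then p * E u' v' else 0) else 0) =
        p ^ 2 * Z + if u = v then p * ∑ u' ∈ L, E u' u' else 0 := by
        intro u _ v _
        simp only [Finset.sum_add_distrib, ← Finset.mul_sum, hsum]
        congr 1
        split_ifs
        · rw [Finset.mul_sum]
          refine Finset.sum_congr rfl fun u' hu' => ?_
          rw [Finset.sum_ite_eq, if_pos hu']
        · simp
      rw [Finset.sum_congr rfl fun u hu => Finset.sum_congr rfl fun v hv => i1 u hu v hv]
      simp only [Finset.sum_add_distrib, Finset.sum_const, nsmul_eq_mul]
      rw [Finset.sum_congr rfl fun u hu => by rw [Finset.sum_ite_eq, if_pos hu], Finset.sum_const,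
        nsmul_eq_mul]
      ring
    rw [e3]
    have hL'p : #L' * p ≤ d := le_trans (by gcongr; exact hcard _) hV
    have hdiag0 : 0 ≤ ∑ u' ∈ L, E u' u' :=
      Finset.sum_nonneg fun u' _ => bernoulliExp_nonneg hp0 hp1 fun ω => by positivity
    calc (#L' * p) ^ 2 * Z + #L' * p * ∑ u' ∈ L, E u' u' ≤ d ^ 2 * Z + d * Z := by
          gcongr
      _ ≤ (1 + d + d ^ 2) * Z := by linarith
      _ ≤ (1 + d + d ^ 2) * (1 + d + d ^ 2) ^ j := by gcongr
      _ = _ := by ring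

lemma bernoulliExp_overlaps_le {n : ℕ} (hp0 : 0 ≤ p) (hp1 : p ≤ 1) (hn : 0 < n)
    (hV : Fintype.card V = n) (hnp : n * p ≤ d) (w : V) (j : ℕ) :
    bernoulliExp p (vertexPairs V) (fun ω => overlaps ω c w j) ≤
      j * (1 + d + d ^ 2) ^ j / n := by
  have hd : 0 ≤ d := le_trans (by positivity) hnp
  have hn' : (0 : ℝ) < n := by exact_mod_cast hn
  induction j with
  | zero =>
    rw [Nat.cast_zero, zero_mul, zero_div, ← bernoulliExp_const (p := p) (A := vertexPairs V) 0]
    refine bernoulliExp_mono hp0 hp1 fun ω => (Finset.sum_eq_zero fun u _ => ?_).le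
    simp only [descents]
    split_ifs <;> simp
  | succ j ih =>
    set L := layer c j with hL
    set L' := layer c (j + 1) with hL'
    have hcard : (#L' : ℝ) ≤ n := by
      rw [← hV]; exact_mod_cast Finset.card_le_univ (layer c (j + 1))
    -- Two distinct paths either part at the first step, or pass through a common vertex `u'`.
    have e1 : ∀ ω : Finset (Sym2 V), overlaps ω c w (j + 1) =
        ∑ u ∈ L', ∑ u' ∈ L, ∑ v' ∈ L,
          ((if s(u, u') ∈ ω then 1 else 0) * (if s(u, v') ∈ ω then 1 else 0)) *
            (if u' = v' then (descents ω c w j u' : ℝ) ^ 2 - descents ω c w j u'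
              else (descents ω c w j u' : ℝ) * descents ω c w j v') := by
      intro ω
      refine Finset.sum_congr rfl fun u _ => ?_
      rw [descents_succ, sq, Finset.sum_mul_sum, ← Finset.sum_sub_distrib]
      refine Finset.sum_congr rfl fun u' hu' => ?_
      rw [← Finset.add_sum_erase _ _ hu', ← Finset.add_sum_erase _ _ hu', if_pos rfl,
        add_sub_right_comm]
      congr 1
      · split_ifs <;> ring
      · refine Finset.sum_congr rfl fun v' hv' => ?_
        rw [if_neg (Finset.ne_of_mem_erase hv').symm]
        ring
    simp only [e1, bernoulliExp_sum]
    have e2 : ∀ u ∈ L', ∀ u' ∈ L, ∀ v' ∈ L, bernoulliExp p (vertexPairs V) (fun ω =>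
          ((if s(u, u') ∈ ω then 1 else 0) * (if s(u, v') ∈ ω then 1 else 0)) *
            (if u' = v' then (descents ω c w j u' : ℝ) ^ 2 - descents ω c w j u'
              else (descents ω c w j u' : ℝ) * descents ω c w j v')) ≤
        p ^ 2 * bernoulliExp p (vertexPairs V)
          (fun ω => (descents ω c w j u' : ℝ) * descents ω c w j v') +
        if u' = v' then p * bernoulliExp p (vertexPairs V)
          (fun ω => (descents ω c w j u' : ℝ) ^ 2 - descents ω c w j u') else 0 := by
      intro u hu u' hu' v' hv'
      have h0 : 0 ≤ bernoulliExp p (vertexPairs V)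
          (fun ω => (descents ω c w j u' : ℝ) * descents ω c w j v') :=
        bernoulliExp_nonneg hp0 hp1 fun ω => by positivity
      by_cases h : u' = v'
      · subst h
        simp only [if_true]
        rw [bernoulliExp_two_edges_mul hu hu hu' hu'
          ((determinedOn_descents j hu').comp fun t => t ^ 2 - t)]
        simp only [and_self, if_true]
        have : 0 ≤ p ^ 2 * bernoulliExp p (vertexPairs V)
          (fun ω => (descents ω c w j u' : ℝ) * descents ω c w j u') := by positivity
        linarith
      · simp only [h, if_false, add_zero]
        rw [bernoulliExp_two_edges_mul hu hu hu' hv'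
          ((determinedOn_descents j hu').mul (determinedOn_descents j hv'))]
        simp [h]
    refine (Finset.sum_le_sum fun u hu => Finset.sum_le_sum
      fun u' hu' => Finset.sum_le_sum fun v' hv' => e2 u hu u' hu' v' hv').trans ?_
    have e3 : ∀ u ∈ L', ∑ u' ∈ L, ∑ v' ∈ L, (p ^ 2 * bernoulliExp p (vertexPairs V)
          (fun ω => (descents ω c w j u' : ℝ) * descents ω c w j v') +
        if u' = v' then p * bernoulliExp p (vertexPairs V)
          (fun ω => (descents ω c w j u' : ℝ) ^ 2 - descents ω c w j u') else 0) =
        p ^ 2 * bernoulliExp p (vertexPairs V)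
          (fun ω => (∑ u ∈ L, (descents ω c w j u : ℝ)) ^ 2) +
        p * bernoulliExp p (vertexPairs V) (fun ω => overlaps ω c w j) := by
      intro u _
      simp only [Finset.sum_add_distrib, ← Finset.mul_sum, ← bernoulliExp_sum, sq,
        Finset.sum_mul_sum, overlaps]
      congr 1
      rw [bernoulliExp_sum, Finset.mul_sum]
      exact Finset.sum_congr rfl fun u' hu' => by rw [Finset.sum_ite_eq, if_pos hu']
    rw [Finset.sum_congr rfl e3, Finset.sum_const, nsmul_eq_mul]
    have hZ := bernoulliExp_sq_sum_descents_le (c := c) (d := d) hp0 hp1 (by rw [hV]; exact hnp) w j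
    have hQ0 : 0 ≤ bernoulliExp p (vertexPairs V) (fun ω => overlaps ω c w j) :=
      bernoulliExp_nonneg hp0 hp1 fun ω => overlaps_nonneg j
    have hZ0 : 0 ≤ bernoulliExp p (vertexPairs V)
          (fun ω => (∑ u ∈ L, (descents ω c w j u : ℝ)) ^ 2) :=
      bernoulliExp_nonneg hp0 hp1 fun ω => by positivity
    set B := 1 + d + d ^ 2 with hB
    calc (#L' : ℝ) * (p ^ 2 * bernoulliExp p (vertexPairs V)
          (fun ω => (∑ u ∈ L, (descents ω c w j u : ℝ)) ^ 2) +
        p * bernoulliExp p (vertexPairs V) (fun ω => overlaps ω c w j))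
        ≤ n * (p ^ 2 * B ^ j + p * (j * B ^ j / n)) := by gcongr
      _ = (n * p) ^ 2 * B ^ j / n + (n * p) * (j * B ^ j / n) := by field_simp
      _ ≤ d ^ 2 * B ^ j / n + d * (j * B ^ j / n) := by gcongr
      _ ≤ B * B ^ j / n + B * (j * B ^ j / n) := by
          gcongr
          · rw [hB]; linarith
          · rw [hB]; nlinarith
      _ = _ := by push_cast; ring

open Classical in
/-- The maximum degree of the power graph is almost the number of descending paths from a fertile
vertex of height `r`, unless there is no such vertex or there are many overlaps. -/
lemma bernoulliExp_maxDegreePower_lt_le {r n : ℕ} (hr : 1 ≤ r) (hp0 : 0 ≤ p) (hp1 : p ≤ 1)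
    (hn : 0 < n) (hV : Fintype.card V = n) (hnp : n * p ≤ d) {m t k : ℝ} (hm : 0 < m) (ht : 0 < t)
    (hk : k ≤ ∏ i ∈ Finset.range r, (b i : ℝ) - t) :
    bernoulliExp p (vertexPairs V) (fun ω =>
      if ((SimpleGraph.fromEdgeSet (ω : Set (Sym2 V))).maxDegreePower r : ℝ) < k then 1 else 0) ≤
      bernoulliExp p (vertexPairs V) (fun ω => if (#(fertile ω c b r) : ℝ) < m then 1 else 0) +
        r * (1 + d + d ^ 2) ^ r / t := by
  have hn' : (0 : ℝ) < n := by exact_mod_cast hn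
  have hd : 0 ≤ d := le_trans (by positivity) hnp
  have hE : bernoulliExp p (vertexPairs V) (fun ω => ∑ w ∈ layer c 0, overlaps ω c w r) ≤
      r * (1 + d + d ^ 2) ^ r := by
    rw [bernoulliExp_sum]
    refine (Finset.sum_le_sum fun w _ => bernoulliExp_overlaps_le hp0 hp1 hn hV hnp w r).trans ?_
    have : (#(layer c 0) : ℝ) ≤ n := by
      rw [← hV]; exact_mod_cast Finset.card_le_univ (layer c 0)
    rw [Finset.sum_const, nsmul_eq_mul]
    calc (#(layer c 0) : ℝ) * (r * (1 + d + d ^ 2) ^ r / n)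
        ≤ n * (r * (1 + d + d ^ 2) ^ r / n) := by gcongr
      _ = _ := by field_simp
  have hM := (bernoulliExp_markov (A := vertexPairs V) hp0 hp1 ht fun ω =>
    Finset.sum_nonneg fun w (_ : w ∈ layer c 0) => overlaps_nonneg (ω := ω) (c := c) (w := w) r).trans
      (div_le_div_of_nonneg_right hE ht.le)
  refine le_trans ?_ (add_le_add_right hM _)
  rw [← bernoulliExp_add]
  refine bernoulliExp_mono hp0 hp1 fun ω => ?_
  by_cases h1 : (#(fertile ω c b r) : ℝ) < m
  · rw [if_pos h1]
    split_ifs <;> norm_num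
  by_cases h2 : t ≤ ∑ w ∈ layer c 0, overlaps ω c w r
  · rw [if_pos h2]
    split_ifs <;> norm_num
  rw [if_neg h1, if_neg h2, if_neg]
  · simp
  · rw [not_lt] at h1 ⊢
    rw [not_le] at h2
    have hpos : 0 < #(fertile ω c b r) := by
      have := hm.trans_le h1
      exact_mod_cast this
    obtain ⟨v, hv⟩ := Finset.card_pos.1 hpos
    have h3 := sum_descents_sub_overlaps_le_degree (ω := ω) hr (fertile_subset_layer r hv)
    have h4 : (∏ i ∈ Finset.range r, (b i : ℝ)) ≤ ∑ w ∈ layer c 0, (descents ω c w r v : ℝ) := by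
      exact_mod_cast prod_le_sum_descents hv
    have h5 : (((SimpleGraph.fromEdgeSet (ω : Set (Sym2 V))).graphPower r).degree v : ℝ) ≤
        (SimpleGraph.fromEdgeSet (ω : Set (Sym2 V))).maxDegreePower r := by
      exact_mod_cast SimpleGraph.degree_le_maxDegree _ v
    linarith

end DescendingPaths

/-! ### Iterated logarithms -/

section Asymptotics

lemma iteratedLog_succ (k : ℕ) (x : ℝ) : iteratedLog (k + 1) x = Real.log (iteratedLog k x) :=
  Function.iterate_succ_apply' _ _ _

lemma tendsto_iteratedLog (k : ℕ) : Tendsto (fun n : ℕ => iteratedLog k n) atTop atTop := by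
  induction k with
  | zero => exact tendsto_natCast_atTop_atTop
  | succ k ih =>
    simp only [iteratedLog_succ]
    exact Real.tendsto_log_atTop.comp ih

lemma eventually_iteratedLog_le {j k : ℕ} (h : j ≤ k) :
    ∀ᶠ n : ℕ in atTop, iteratedLog k n ≤ iteratedLog j n := by
  induction k, h using Nat.le_induction with
  | base => exact Eventually.of_forall fun _ => le_rfl
  | succ k _ ih =>
    filter_upwards [ih, (tendsto_iteratedLog k).eventually_ge_atTop 0] with n h1 h2
    rw [iteratedLog_succ]
    exact (Real.log_le_self h2).trans h1

/-! ### The upper tail -/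

lemma eventually_rpow_le_mul {s η : ℝ} (hs : s < 1) (hη : 0 < η) :
    ∀ᶠ y : ℝ in atTop, y ^ s ≤ η * y := by
  have h := (tendsto_rpow_neg_atTop (show 0 < 1 - s by linarith)).eventually_le_const hη
  filter_upwards [h, eventually_gt_atTop 0] with y hy hy0
  calc y ^ s = y ^ (-(1 - s)) * y := by
        rw [← Real.rpow_add_one hy0.ne']; congr 1; ring
    _ ≤ η * y := by gcongr

lemma eventually_mul_progenyBound_le {d δ : ℝ} (hd : 0 < d) (hδ : 0 < δ) (hδ1 : δ < 1) {r : ℕ}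
    (i : ℕ) (hi : i < r) {η : ℝ} (hη : 0 < η) :
    ∀ᶠ n : ℕ in atTop, iteratedLog r n ^ (1 - δ) *
      progenyBound d (iteratedLog r n ^ (1 - δ)) i ≤ η * iteratedLog (r - i) n := by
  induction i generalizing η with
  | zero =>
    filter_upwards [(tendsto_iteratedLog r).eventually
      (eventually_rpow_le_mul (s := 1 - δ) (by linarith) hη)] with n hn
    simpa [progenyBound] using hn
  | succ i ih =>
    obtain ⟨m, hm⟩ : ∃ m, r - i = m + 1 := ⟨r - i - 1, by omega⟩
    have hm' : r - (i + 1) = m := by omega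
    rw [hm']
    filter_upwards [ih (by omega) (η := δ / (2 * d)) (by positivity),
      (tendsto_iteratedLog m).eventually
        (eventually_rpow_le_mul (s := 1 - δ / 2) (by linarith) hη),
      eventually_iteratedLog_le (show m ≤ r by omega),
      (tendsto_iteratedLog m).eventually_gt_atTop 0,
      (tendsto_iteratedLog r).eventually_gt_atTop 0] with n h1 h2 h3 h4 h5
    rw [hm, iteratedLog_succ] at h1
    refine le_trans ?_ h2
    have h6 : progenyBound d (iteratedLog r n ^ (1 - δ)) (i + 1) ≤
        iteratedLog m n ^ (δ / 2) := by
      rw [progenyBound, Real.rpow_def_of_pos h4, Real.exp_le_exp]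
      calc d * (iteratedLog r n ^ (1 - δ) * progenyBound d (iteratedLog r n ^ (1 - δ)) i)
          ≤ d * (δ / (2 * d) * Real.log (iteratedLog m n)) := by gcongr
        _ = _ := by field_simp
    calc iteratedLog r n ^ (1 - δ) * progenyBound d (iteratedLog r n ^ (1 - δ)) (i + 1)
        ≤ iteratedLog m n ^ (1 - δ) * iteratedLog m n ^ (δ / 2) := by
          refine mul_le_mul (Real.rpow_le_rpow h5.le h3 (by linarith)) h6 ?_
            (Real.rpow_nonneg h4.le _)
          exact zero_le_one.trans (one_le_progenyBound hd.le (Real.rpow_nonneg h5.le _) _)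
      _ = _ := by rw [← Real.rpow_add h4]; congr 1; ring

open Classical in
lemma tendsto_bernoulliExp_lt_maxDegreePower {d ε : ℝ} (hd : 0 < d) (hε : 0 < ε) {r : ℕ}
    (hr : 1 ≤ r) :
    Tendsto (fun n : ℕ => bernoulliExp (d / n) (vertexPairs (Fin n)) (fun ω =>
      if (1 + ε) * (Real.log n / iteratedLog (r + 1) n) <
        ((SimpleGraph.fromEdgeSet (ω : Set (Sym2 (Fin n)))).maxDegreePower r : ℝ)
      then 1 else 0)) atTop (𝓝 0) := by
  set δ := ε / (2 * (1 + ε)) with hδ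
  have hδ0 : 0 < δ := by positivity
  have hδ1 : δ < 1 := by rw [hδ, div_lt_one (by positivity)]; linarith
  have hδε : (1 - δ) * (1 + ε) = 1 + ε / 2 := by rw [hδ]; field_simp; ring
  have hlim : Tendsto (fun n : ℕ => Real.exp (-(ε / 4 * iteratedLog 1 n))) atTop (𝓝 0) :=
    Real.tendsto_exp_neg_atTop_nhds_zero.comp
      ((tendsto_iteratedLog 1).const_mul_atTop (by positivity))
  have hbd : ∀ᶠ n : ℕ in atTop, 0 < (n : ℝ) ∧ d / n ≤ 1 := by
    filter_upwards [tendsto_natCast_atTop_atTop.eventually_ge_atTop d,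
      tendsto_natCast_atTop_atTop.eventually_gt_atTop (0 : ℝ)] with n h1 h2
    exact ⟨h2, by rwa [div_le_one h2]⟩
  refine squeeze_zero' ?_ ?_ hlim
  · filter_upwards [hbd] with n hn
    exact bernoulliExp_nonneg (div_nonneg hd.le hn.1.le) hn.2 fun ω => by split_ifs <;> simp
  · filter_upwards [hbd, eventually_mul_progenyBound_le hd hδ0 hδ1 (r - 1) (r := r) (by omega)
        (η := ε / (4 * d)) (by positivity), (tendsto_iteratedLog r).eventually_ge_atTop 1,
      (tendsto_iteratedLog (r + 1)).eventually_gt_atTop 0] with n hn h1 h2 h3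
    have hl : iteratedLog 1 n = Real.log n := rfl
    have : Nonempty (Fin n) := ⟨⟨0, by exact_mod_cast hn.1⟩⟩
    set x := iteratedLog r n ^ (1 - δ) with hx
    have hx1 : 1 ≤ x := Real.one_le_rpow h2 (by linarith)
    refine (bernoulliExp_lt_maxDegreePower_le (div_nonneg hd.le hn.1.le) hn.2 hd.le ?_ hx1 r _).trans
      ?_
    · rw [Fintype.card_fin, mul_div_cancel₀ _ hn.1.ne']
    · rw [show r - (r - 1) = 1 by omega] at h1
      obtain ⟨s, rfl⟩ : ∃ s, r = s + 1 := ⟨r - 1, by omega⟩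
      rw [Nat.add_sub_cancel] at h1
      have h4 : progenyBound d x (s + 1) ≤ Real.exp (ε / 4 * iteratedLog 1 n) := by
        rw [progenyBound, Real.exp_le_exp]
        calc d * (x * progenyBound d x s) ≤ d * (ε / (4 * d) * iteratedLog 1 n) := by gcongr
          _ = _ := by field_simp
      have h5 : x ^ (-((1 + ε) * (Real.log n / iteratedLog (s + 1 + 1) n))) =
          Real.exp (-((1 + ε / 2) * iteratedLog 1 n)) := by
        rw [hx, ← Real.rpow_mul (by linarith), Real.rpow_def_of_pos (by linarith),
          ← iteratedLog_succ, hl, ← hδε]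
        congr 1
        field_simp
      rw [h5, Fintype.card_fin]
      calc n * progenyBound d x (s + 1) * Real.exp (-((1 + ε / 2) * iteratedLog 1 n))
          ≤ Real.exp (iteratedLog 1 n) * Real.exp (ε / 4 * iteratedLog 1 n) *
            Real.exp (-((1 + ε / 2) * iteratedLog 1 n)) := by
            rw [hl, Real.exp_log hn.1]
            gcongr
            exact h4
        _ = _ := by
            rw [← Real.exp_add, ← Real.exp_add]
            congr 1
            ring

/-! ### The lower tail -/

lemma log_natCeil_le {y : ℝ} (hy : 1 ≤ y) : Real.log ⌈y⌉₊ ≤ Real.log y + 1 := by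
  have h1 : (⌈y⌉₊ : ℝ) ≤ 2 * y := by
    have := Nat.ceil_lt_add_one (zero_le_one.trans hy)
    linarith
  have h0 : (0 : ℝ) < ⌈y⌉₊ := by
    have := Nat.le_ceil y
    linarith
  calc Real.log ⌈y⌉₊ ≤ Real.log (Real.exp 1 * y) := by
        refine Real.log_le_log h0 (h1.trans ?_)
        have := Real.add_one_le_exp 1
        gcongr
        linarith
    _ = _ := by
        rw [Real.log_mul (Real.exp_pos _).ne' (by linarith), Real.log_exp, add_comm]

lemma extinctionCost_mono {C : ℝ} (hC : 0 ≤ C) {b : ℕ → ℕ} (hb : ∀ i, 1 ≤ b i) :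
    Monotone (extinctionCost C b) := by
  have h0 : ∀ j, 0 ≤ extinctionCost C b j := by
    intro j
    induction j with
    | zero => exact hC
    | succ j ih =>
      have := Real.log_natCast_nonneg (b j)
      rw [extinctionCost]
      positivity
  refine monotone_nat_of_le_succ fun j => ?_
  have h1 := Real.log_natCast_nonneg (b j)
  have h2 : (1 : ℝ) ≤ b j := by exact_mod_cast hb j
  rw [extinctionCost]
  nlinarith [h0 j]

/-- Only the lowest level contributes more than a bounded cost per descending path. -/
lemma extinctionCost_le {C l : ℝ} (hC : 0 ≤ C) {b : ℕ → ℕ} (hb : ∀ i, 1 ≤ b i) {s : ℕ}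
    (h0 : Real.log (b 0) ≤ l) (h : ∀ i < s, Real.log (b (i + 1)) ≤ 2 * b i) :
    extinctionCost C b (s + 1) ≤
      (∏ i ∈ Finset.range (s + 1), (b i : ℝ)) * (l + (s + 2) * (2 + C)) := by
  have hb' : ∀ i, (1 : ℝ) ≤ b i := fun i => by exact_mod_cast hb i
  have hP : ∀ j, (1 : ℝ) ≤ ∏ i ∈ Finset.range j, (b i : ℝ) := fun j =>
    Finset.one_le_prod fun i _ => hb' i
  have key : ∀ j ≤ s, extinctionCost C b j + Real.log (b j) ≤
      (∏ i ∈ Finset.range j, (b i : ℝ)) * (l + C + j * (2 + C)) := by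
    intro j hj
    induction j with
    | zero => simp [extinctionCost]; linarith
    | succ j ih =>
      have h1 := ih (by omega)
      have h2 := h j hj
      have h3 : (b j : ℝ) * (extinctionCost C b j + Real.log (b j)) ≤
          b j * ((∏ i ∈ Finset.range j, (b i : ℝ)) * (l + C + j * (2 + C))) :=
        mul_le_mul_of_nonneg_left h1 (by positivity)
      have h4 : (b j : ℝ) * (2 + C) ≤ b j * (∏ i ∈ Finset.range j, (b i : ℝ)) * (2 + C) := by
        have := hP j
        gcongr
        exact le_mul_of_one_le_right (by positivity) this
      rw [extinctionCost, Finset.prod_range_succ]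
      push_cast
      linarith
  have h1 := key s le_rfl
  have h3 : (b s : ℝ) * (extinctionCost C b s + Real.log (b s)) ≤
      b s * ((∏ i ∈ Finset.range s, (b i : ℝ)) * (l + C + s * (2 + C))) :=
    mul_le_mul_of_nonneg_left h1 (by positivity)
  have h4 : (b s : ℝ) * C ≤ b s * (∏ i ∈ Finset.range s, (b i : ℝ)) * C := by
    have := hP s
    gcongr
    exact le_mul_of_one_le_right (by positivity) this
  have h5 : (0 : ℝ) ≤ b s * (∏ i ∈ Finset.range s, (b i : ℝ)) := by positivity
  rw [extinctionCost, Finset.prod_range_succ]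
  linarith

/-- For `i < s`, vertices of height `i + 1` are asked for about `log_{(s + 1 - i)} n` fertile
children; the number of children of the roots, which have height `s + 1`, is chosen so that the
number of descending paths from a root is about `M`. -/
noncomputable def branching (s n : ℕ) (M : ℝ) (i : ℕ) : ℕ :=
  if i < s then ⌈iteratedLog (s + 1 - i) n⌉₊
  else ⌈M / ∏ k ∈ Finset.range s, (⌈iteratedLog (s + 1 - k) n⌉₊ : ℝ)⌉₊

lemma prod_branching (s n : ℕ) (M : ℝ) : ∏ i ∈ Finset.range s, (branching s n M i : ℝ) =
    ∏ k ∈ Finset.range s, (⌈iteratedLog (s + 1 - k) n⌉₊ : ℝ) :=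
  Finset.prod_congr rfl fun i hi => by rw [branching, if_pos (Finset.mem_range.1 hi)]

lemma eventually_prod_mul_le (s : ℕ) {η : ℝ} (hη : 0 < η) : ∀ᶠ n : ℕ in atTop,
    (∏ k ∈ Finset.range s, (⌈iteratedLog (s + 1 - k) n⌉₊ : ℝ)) * iteratedLog (s + 2) n ≤
      η * iteratedLog 1 n := by
  have h1 : ∀ᶠ n : ℕ in atTop, ∀ k ∈ Finset.range s,
      iteratedLog (s + 1 - k) n ≤ iteratedLog 2 n := by
    rw [Filter.eventually_all_finset]
    intro k hk
    have := Finset.mem_range.1 hk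
    exact eventually_iteratedLog_le (by omega)
  have h2 := (Real.isLittleO_pow_exp_atTop (n := s + 1)).bound
    (show 0 < η / 2 ^ (s + 1) by positivity)
  filter_upwards [h1, (tendsto_iteratedLog 2).eventually h2,
    (tendsto_iteratedLog 2).eventually_ge_atTop 1, (tendsto_iteratedLog 1).eventually_gt_atTop 0,
    eventually_iteratedLog_le (show 2 ≤ s + 2 by omega),
    (tendsto_iteratedLog (s + 2)).eventually_ge_atTop 0] with n h1 h2 h3 h4 h5 h6
  have h7 : (∏ k ∈ Finset.range s, (⌈iteratedLog (s + 1 - k) n⌉₊ : ℝ)) ≤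
      ∏ k ∈ Finset.range s, (2 * iteratedLog 2 n) := by
    refine Finset.prod_le_prod (fun _ _ => by positivity) fun k hk => ?_
    have h8 := h1 k hk
    have h9 : ⌈iteratedLog (s + 1 - k) n⌉₊ ≤ ⌈iteratedLog 2 n⌉₊ := Nat.ceil_mono h8
    have h10 : (⌈iteratedLog (s + 1 - k) n⌉₊ : ℝ) ≤ ⌈iteratedLog 2 n⌉₊ := by exact_mod_cast h9
    have := Nat.ceil_lt_add_one (zero_le_one.trans h3)
    linarith
  rw [Finset.prod_const, Finset.card_range] at h7
  rw [iteratedLog_succ 1, Real.exp_log h4, ← iteratedLog_succ 1, Real.norm_of_nonneg (by positivity),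
    Real.norm_of_nonneg h4.le] at h2
  calc _ ≤ (2 * iteratedLog 2 n) ^ s * (2 * iteratedLog 2 n) := by
        gcongr
        linarith
    _ = 2 ^ (s + 1) * iteratedLog 2 n ^ (s + 1) := by ring
    _ ≤ 2 ^ (s + 1) * (η / 2 ^ (s + 1) * iteratedLog 1 n) := by gcongr
    _ = _ := by field_simp

/-- The thresholds `branching` yield at least `(1 - ε) * log n / log_{(s + 2)} n` descending paths
at a cost of less than `log n`. -/
lemma eventually_branching {ε C : ℝ} (hε : 0 < ε) (hε1 : ε < 1) (hC : 0 ≤ C) (s : ℕ) :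
    ∀ᶠ n : ℕ in atTop, ∀ b, b = branching s n ((1 - ε) * (Real.log n / iteratedLog (s + 2) n)) →
      (∀ i, 1 ≤ b i) ∧ (∀ i < s + 1, (b i : ℝ) ≤ Real.log n + 1) ∧
      (1 - ε) * (Real.log n / iteratedLog (s + 2) n) ≤ ∏ i ∈ Finset.range (s + 1), (b i : ℝ) ∧
      extinctionCost C b (s + 1) ≤ (1 - ε / 2) * Real.log n := by
  set C₂ := 1 + (s + 2) * (2 + C) with hC₂
  have hC₂0 : 0 < C₂ := by positivity
  have hle : ∀ᶠ n : ℕ in atTop, ∀ k ∈ Finset.range (s + 1),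
      1 ≤ iteratedLog (k + 1) n ∧ iteratedLog (k + 1) n ≤ iteratedLog 1 n := by
    rw [Filter.eventually_all_finset]
    intro k _
    exact ((tendsto_iteratedLog _).eventually_ge_atTop 1).and
      (eventually_iteratedLog_le (by omega))
  filter_upwards [hle, eventually_prod_mul_le s (η := ε / (4 * (1 + C₂))) (by positivity),
    (tendsto_iteratedLog (s + 2)).eventually_ge_atTop (max 1 (4 * C₂ / ε)),
    (tendsto_iteratedLog 1).eventually_ge_atTop 1] with n hle hA hl hlog b hb
  have hl1 : 1 ≤ iteratedLog (s + 2) n := (le_max_left _ _).trans hl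
  have hl2 : 4 * C₂ / ε ≤ iteratedLog (s + 2) n := (le_max_right _ _).trans hl
  change 1 ≤ Real.log n at hlog
  change _ ≤ _ * Real.log n at hA
  change ∀ k ∈ _, _ ∧ _ ≤ Real.log n at hle
  set A : ℝ := ∏ k ∈ Finset.range s, (⌈iteratedLog (s + 1 - k) n⌉₊ : ℝ) with hAdef
  set M := (1 - ε) * (Real.log n / iteratedLog (s + 2) n) with hM
  have hM0 : 0 < M := by
    have : 0 < 1 - ε := by linarith
    positivity
  have hlev : ∀ i < s + 1, 1 ≤ iteratedLog (s + 1 - i) n ∧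
      iteratedLog (s + 1 - i) n ≤ Real.log n := by
    intro i hi
    have := hle (s - i) (Finset.mem_range.2 (by omega))
    rwa [show s - i + 1 = s + 1 - i by omega] at this
  have hA1 : 1 ≤ A := Finset.one_le_prod fun k hk => by
    have := (hlev k (by have := Finset.mem_range.1 hk; omega)).1
    exact this.trans (Nat.le_ceil _)
  have hMlog : M / A ≤ Real.log n := by
    calc M / A ≤ M := div_le_self hM0.le hA1
      _ ≤ 1 * (Real.log n / 1) := by
          rw [hM]; gcongr
          linarith
      _ = _ := by ring
  have hblt : ∀ i < s, b i = ⌈iteratedLog (s + 1 - i) n⌉₊ := fun i hi => by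
    rw [hb, branching, if_pos hi]
  have hbge : ∀ i, ¬ i < s → b i = ⌈M / A⌉₊ := fun i hi => by
    rw [hb, branching, if_neg hi]
  have hbub : ∀ i < s + 1, b i ≤ ⌈iteratedLog (s + 1 - i) n⌉₊ := by
    intro i hi
    by_cases his : i < s
    · rw [hblt i his]
    · rw [hbge i his, show s + 1 - i = 1 by omega]
      exact Nat.ceil_mono hMlog
  have hb1 : ∀ i, 1 ≤ b i := by
    intro i
    by_cases his : i < s
    · rw [hblt i his]
      exact Nat.one_le_ceil_iff.2 (by linarith [(hlev i (by omega)).1])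
    · rw [hbge i his]
      exact Nat.one_le_ceil_iff.2 (by positivity)
  have hP : ∏ i ∈ Finset.range (s + 1), (b i : ℝ) = A * ⌈M / A⌉₊ := by
    rw [Finset.prod_range_succ, hbge s (lt_irrefl s), hb, prod_branching]
  have hlogb : ∀ i < s + 1, Real.log (b i) ≤ iteratedLog (s + 2 - i) n + 1 := by
    intro i hi
    have h1 : (b i : ℝ) ≤ ⌈iteratedLog (s + 1 - i) n⌉₊ := by exact_mod_cast hbub i hi
    have h2 : (0 : ℝ) < b i := by exact_mod_cast hb1 i
    refine (Real.log_le_log h2 h1).trans ?_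
    refine (log_natCeil_le (hlev i hi).1).trans ?_
    rw [show s + 2 - i = s + 1 - i + 1 by omega, iteratedLog_succ]
  refine ⟨hb1, fun i hi => ?_, ?_, ?_⟩
  · have h1 : (b i : ℝ) ≤ ⌈iteratedLog (s + 1 - i) n⌉₊ := by exact_mod_cast hbub i hi
    have h2 := hlev i hi
    have := Nat.ceil_lt_add_one (zero_le_one.trans h2.1)
    linarith
  · rw [hP]
    calc M = A * (M / A) := by field_simp
      _ ≤ _ := by gcongr; exact Nat.le_ceil _
  · have hcost := extinctionCost_le hC (l := iteratedLog (s + 2) n + 1) hb1 (s := s)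
      (hlogb 0 (by omega)) fun i hi => by
        refine (hlogb (i + 1) (by omega)).trans ?_
        rw [show s + 2 - (i + 1) = s + 1 - i by omega, hblt i hi]
        have h1 := (hlev i (by omega)).1
        have h2 := Nat.le_ceil (iteratedLog (s + 1 - i) (n : ℝ))
        linarith
    refine hcost.trans ?_
    set l := iteratedLog (s + 2) (n : ℝ) with hldef
    rw [hP, show l + 1 + (s + 2) * (2 + C) = l + C₂ by rw [hC₂]; ring]
    have hceil : A * ⌈M / A⌉₊ ≤ M + A := by
      have := Nat.ceil_lt_add_one (show 0 ≤ M / A by positivity)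
      calc A * ⌈M / A⌉₊ ≤ A * (M / A + 1) := by gcongr
        _ = _ := by field_simp
    have hMl : M * l = (1 - ε) * Real.log n := by rw [hM]; field_simp
    have hMC : M * C₂ ≤ ε / 4 * Real.log n := by
      have h1 : C₂ ≤ ε / 4 * l := by
        rw [div_le_iff₀ hε] at hl2
        linarith
      calc M * C₂ ≤ M * (ε / 4 * l) := by gcongr
        _ = ε / 4 * ((1 - ε) * Real.log n) := by rw [← hMl]; ring
        _ ≤ ε / 4 * (1 * Real.log n) := by gcongr; linarith
        _ = _ := by ring
    have hAC : A * (l + C₂) ≤ ε / 4 * Real.log n := by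
      calc A * (l + C₂) ≤ A * (l + C₂ * l) := by gcongr; exact le_mul_of_one_le_right hC₂0.le hl1
        _ = (1 + C₂) * (A * l) := by ring
        _ ≤ (1 + C₂) * (ε / (4 * (1 + C₂)) * Real.log n) := by gcongr
        _ = _ := by field_simp
    calc A * ⌈M / A⌉₊ * (l + C₂) ≤ (M + A) * (l + C₂) := by gcongr
      _ = M * l + M * C₂ + A * (l + C₂) := by ring
      _ ≤ (1 - ε) * Real.log n + ε / 4 * Real.log n + ε / 4 * Real.log n := by
          rw [hMl]; gcongr
      _ = _ := by ring

lemma card_layer_mod_ge {n r j : ℕ} (hj : j ≤ r) :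
    n / (r + 1) ≤ (layer (fun x : Fin n => x.val % (r + 1)) j).card := by
  have h : ∀ q ∈ Finset.range (n / (r + 1)), q * (r + 1) + j < n := by
    intro q hq
    have h1 := Finset.mem_range.1 hq
    have h2 : (q + 1) * (r + 1) ≤ n / (r + 1) * (r + 1) := by gcongr; omega
    have h3 := Nat.div_mul_le_self n (r + 1)
    rw [add_mul] at h2
    omega
  rw [← Finset.card_range (n / (r + 1)), ← Finset.card_attach]
  refine Finset.card_le_card_of_injOn (fun q => ⟨q.1 * (r + 1) + j, h q.1 q.2⟩) ?_ ?_
  · intro q _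
    simp only [Finset.mem_coe, mem_layer]
    rw [mul_comm, Nat.mul_add_mod, Nat.mod_eq_of_lt (by omega)]
  · intro q _ q' _ hqq
    have : q.1 * (r + 1) + j = q'.1 * (r + 1) + j := by simpa using hqq
    exact Subtype.ext (Nat.eq_of_mul_eq_mul_right (Nat.succ_pos r) (Nat.add_right_cancel this))

open Classical in
lemma tendsto_bernoulliExp_maxDegreePower_lt {d ε : ℝ} (hd : 0 < d) (hε : 0 < ε) (hε1 : ε < 1)
    {r : ℕ} (hr : 1 ≤ r) :
    Tendsto (fun n : ℕ => bernoulliExp (d / n) (vertexPairs (Fin n)) (fun ω =>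
      if ((SimpleGraph.fromEdgeSet (ω : Set (Sym2 (Fin n)))).maxDegreePower r : ℝ) <
        (1 - ε) * (Real.log n / iteratedLog (r + 1) n)
      then 1 else 0)) atTop (𝓝 0) := by
  obtain ⟨s, rfl⟩ : ∃ s, r = s + 1 := ⟨r - 1, by omega⟩
  set β : ℝ := 1 / (2 * (s + 2)) with hβ
  have hβ0 : 0 < β := by positivity
  have hβ1 : β ≤ 1 := by rw [hβ, div_le_one (by positivity)]; linarith
  set C := |Real.log (2 / d)| + 2 * d + Real.log (4 / β) with hC
  have hC0 : 0 ≤ C := by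
    have : 0 ≤ Real.log (4 / β) := Real.log_nonneg (by rw [le_div_iff₀ hβ0]; linarith)
    positivity
  set B := ((s + 1 : ℕ) : ℝ) * (1 + d + d ^ 2) ^ (s + 1) with hB
  have hMtop : Tendsto (fun n : ℕ => Real.log n / iteratedLog (s + 2) n) atTop atTop := by
    rw [tendsto_atTop]
    intro y
    filter_upwards [eventually_prod_mul_le s (η := 1 / max y 1) (by positivity),
      (tendsto_iteratedLog (s + 2)).eventually_ge_atTop 1,
      Filter.eventually_all_finset (Finset.range s) |>.2 fun k _ =>
        (tendsto_iteratedLog (s + 1 - k)).eventually_ge_atTop 1] with n h1 h2 h3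
    have hA1 : 1 ≤ ∏ k ∈ Finset.range s, (⌈iteratedLog (s + 1 - k) n⌉₊ : ℝ) :=
      Finset.one_le_prod fun k hk => (h3 k hk).trans (Nat.le_ceil _)
    change _ ≤ _ * Real.log n at h1
    rw [le_div_iff₀ (by linarith)]
    have h4 : iteratedLog (s + 2) n ≤ 1 / max y 1 * Real.log n :=
      (le_mul_of_one_le_left (by linarith) hA1).trans h1
    rw [one_div, ← div_eq_inv_mul, le_div_iff₀ (by positivity)] at h4
    calc y * iteratedLog (s + 2) n ≤ max y 1 * iteratedLog (s + 2) n := by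
          gcongr; exact le_max_left _ _
      _ ≤ _ := by linarith
  have hlim : Tendsto (fun n : ℕ => (s + 1 : ℕ) * Real.exp (-Real.exp (ε / 4 * Real.log n)) +
      B / (ε / 2 * (Real.log n / iteratedLog (s + 2) n))) atTop (𝓝 0) := by
    have h1 : Tendsto (fun n : ℕ => Real.exp (-Real.exp (ε / 4 * Real.log n))) atTop (𝓝 0) :=
      Real.tendsto_exp_neg_atTop_nhds_zero.comp (Real.tendsto_exp_atTop.comp
        ((tendsto_iteratedLog 1).const_mul_atTop (by positivity)))
    have h2 := (h1.const_mul ((s + 1 : ℕ) : ℝ)).add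
      ((hMtop.const_mul_atTop (show 0 < ε / 2 by positivity)).const_div_atTop B)
    simpa using h2
  have hexp := (Real.isLittleO_pow_exp_atTop (n := 1)).bound (show 0 < ε / 16 by positivity)
  have hexp' : Tendsto (fun n : ℕ => ε / 4 * iteratedLog 1 n) atTop atTop :=
    (tendsto_iteratedLog 1).const_mul_atTop (by positivity)
  refine squeeze_zero' ?_ ?_ hlim
  · filter_upwards [tendsto_natCast_atTop_atTop.eventually_ge_atTop d,
      tendsto_natCast_atTop_atTop.eventually_gt_atTop (0 : ℝ)] with n h1 h2
    exact bernoulliExp_nonneg (by positivity) (by rwa [div_le_one h2]) fun ω => by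
      split_ifs <;> simp
  · filter_upwards [eventually_branching (ε := ε / 2) (by positivity) (by linarith) hC0 s,
      tendsto_natCast_atTop_atTop.eventually_ge_atTop (2 * d),
      tendsto_natCast_atTop_atTop.eventually_ge_atTop (2 * ((s : ℝ) + 2)),
      hexp'.eventually hexp, (tendsto_iteratedLog 1).eventually_ge_atTop 1,
      hMtop.eventually_gt_atTop 0] with n hbr hn2 hn3 hex hlog hM
    obtain ⟨hb1, hb2, hP, hcost⟩ := hbr _ rfl
    change 1 ≤ Real.log n at hlog
    change ‖(ε / 4 * Real.log n) ^ 1‖ ≤ ε / 16 * ‖Real.exp (ε / 4 * Real.log n)‖ at hex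
    set M := Real.log n / iteratedLog (s + 2) n with hMdef
    set b := branching s n ((1 - ε / 2) * M) with hb
    have hn0 : (0 : ℝ) < n := by linarith
    have hmon := extinctionCost_mono hC0 hb1
    have hm : ∀ j ≤ s + 1,
        Real.exp (ε / 4 * Real.log n) ≤ n * Real.exp (-extinctionCost C b j) := by
      intro j hj
      calc Real.exp (ε / 4 * Real.log n)
          = Real.exp (Real.log n) * Real.exp (-((1 - ε / 2 / 2) * Real.log n)) := by
            rw [← Real.exp_add]; congr 1; ring
        _ ≤ _ := by
            rw [Real.exp_log hn0]
            gcongr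
            exact (hmon hj).trans hcost
    have hc : ∀ j ≤ s + 1,
        β * n ≤ (layer (fun x : Fin n => x.val % (s + 1 + 1)) j).card := by
      intro j hj
      have h1 : ((n / (s + 1 + 1) : ℕ) : ℝ) ≤
          (layer (fun x : Fin n => x.val % (s + 1 + 1)) j).card := by
        exact_mod_cast card_layer_mod_ge hj
      refine le_trans ?_ h1
      have h2 := Nat.lt_div_mul_add (a := n) (show 0 < s + 1 + 1 by omega)
      have h3 : (n : ℝ) < (n / (s + 1 + 1) : ℕ) * (s + 2) + (s + 2) := by
        have : (n : ℝ) < (n / (s + 1 + 1) : ℕ) * ((s + 1 + 1 : ℕ) : ℝ) + (s + 1 + 1 : ℕ) := by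
          exact_mod_cast h2
        push_cast at this ⊢
        linarith
      rw [hβ, one_div, ← div_eq_inv_mul, div_le_iff₀ (by positivity)]
      linarith
    have hfert := bernoulliExp_card_fertile_lt_le (c := fun x : Fin n => x.val % (s + 1 + 1))
      (b := b) (r := s + 1) hd (Fintype.card_fin n) hn2 hβ0 hβ1 hc hC.ge
      (fun j _ => hb1 j) (fun j hj => by
        refine le_trans ?_ (hm j hj.le)
        have h1 := hb2 j hj
        rw [pow_one, Real.norm_of_nonneg (by positivity),
          Real.norm_of_nonneg (Real.exp_pos _).le] at hex
        have h2 : 4 * Real.log n ≤ Real.exp (ε / 4 * Real.log n) := by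
          refine le_of_mul_le_mul_left ?_ (show 0 < ε / 16 by positivity)
          linarith
        linarith) (s + 1) le_rfl
    have hmain := bernoulliExp_maxDegreePower_lt_le (V := Fin n) (p := d / n) (d := d)
      (c := fun x : Fin n => x.val % (s + 1 + 1)) (b := b) (r := s + 1) (n := n) (by omega)
      (by positivity) (by rw [div_le_one hn0]; linarith) (by exact_mod_cast hn0)
      (Fintype.card_fin n) (by rw [mul_div_cancel₀ _ hn0.ne'])
      (m := n * Real.exp (-extinctionCost C b (s + 1))) (t := ε / 2 * M) (k := (1 - ε) * M)
      (by positivity) (by positivity) (by linarith)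
    refine hmain.trans (add_le_add (hfert.trans ?_) le_rfl)
    calc _ ≤ ∑ i ∈ Finset.range (s + 1), Real.exp (-Real.exp (ε / 4 * Real.log n)) := by
          refine Finset.sum_le_sum fun i hi => ?_
          have := hm (i + 1) (by have := Finset.mem_range.1 hi; omega)
          gcongr
      _ = _ := by rw [Finset.sum_const, Finset.card_range, nsmul_eq_mul]

end Asymptotics

/-! ### The binomial random graph -/

open Classical in
/-- The edge set of the binomial random graph is a binomial random set of pairs. -/
lemma binomialRandom_eq_ofReal_bernoulliExp {V : Type*} [Fintype V] [DecidableEq V]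
    (p : unitInterval) (P : SimpleGraph V → Prop) :
    SimpleGraph.binomialRandom V p {G | P G} =
      ENNReal.ofReal (bernoulliExp p (vertexPairs V)
        (fun ω => if P (SimpleGraph.fromEdgeSet (ω : Set (Sym2 V))) then 1 else 0)) := by
  have hset : ((vertexPairs V : Finset (Sym2 V)) : Set (Sym2 V)) = Sym2.diagSetᶜ := by
    ext e; simp [vertexPairs]
  have hdiff : ∀ ω ⊆ vertexPairs V,
      (SimpleGraph.fromEdgeSet (ω : Set (Sym2 V))).edgeSet = (ω : Set (Sym2 V)) := by
    intro ω hω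
    rw [SimpleGraph.edgeSet_fromEdgeSet, sdiff_eq_left, ← Set.subset_compl_iff_disjoint_right]
    rw [← hset]
    exact_mod_cast hω
  set F : Finset (Finset (Sym2 V)) := (vertexPairs V).powerset.filter fun ω =>
    P (SimpleGraph.fromEdgeSet (ω : Set (Sym2 V))) with hF
  have himage : {s ∈ SimpleGraph.edgeSet '' {G : SimpleGraph V | P G} | s ⊆ Sym2.diagSetᶜ} =
      ⋃ ω ∈ F, {(ω : Set (Sym2 V))} := by
    ext s
    simp only [Set.mem_ofPred_eq, Set.mem_image, Set.mem_iUnion, hF, Finset.mem_filter,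
      Finset.mem_powerset, Set.mem_singleton_iff, exists_prop]
    constructor
    · rintro ⟨⟨G, hG, rfl⟩, hs⟩
      refine ⟨G.edgeSet.toFinset, ⟨?_, by simpa using hG⟩, by simp⟩
      rw [← Finset.coe_subset, hset]
      simp
    · rintro ⟨ω, ⟨hω, hP⟩, rfl⟩
      refine ⟨⟨_, hP, hdiff ω hω⟩, ?_⟩
      rw [← hset]
      exact_mod_cast hω
  have hsing : ∀ ω ⊆ vertexPairs V,
      ProbabilityTheory.setBernoulli Sym2.diagSetᶜ p {(ω : Set (Sym2 V))} =
      ENNReal.ofReal ((p : ℝ) ^ ω.card * (1 - (p : ℝ)) ^ ((vertexPairs V).card - ω.card)) := by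
    intro ω hω
    have h1 : (ω : Set (Sym2 V)) ⊆ Sym2.diagSetᶜ := by rw [← hset]; exact_mod_cast hω
    rw [← ENNReal.ofReal_toReal (MeasureTheory.measure_ne_top _ _), ← MeasureTheory.measureReal_def,
      ProbabilityTheory.setBernoulli_real_singleton p h1 (Set.toFinite _), ← hset,
      ← Finset.coe_sdiff, Set.ncard_coe_finset, Set.ncard_coe_finset, Finset.card_sdiff_of_subset hω]
  have hp1 : 0 ≤ 1 - (p : ℝ) := by linarith [p.2.2]
  rw [SimpleGraph.binomialRandom_apply', ProbabilityTheory.setBernoulli_apply_eq_apply_subsets,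
    himage, MeasureTheory.measure_biUnion_finset]
  · rw [bernoulliExp]
    simp only [mul_ite, mul_one, mul_zero]
    rw [← Finset.sum_filter, ← hF, ENNReal.ofReal_sum_of_nonneg fun ω _ => by
      have := p.2.1
      positivity]
    exact Finset.sum_congr rfl fun ω hω =>
      hsing ω (Finset.mem_powerset.1 (Finset.mem_filter.1 hω).1)
  · intro ω _ ω' _ hne
    simpa [Function.onFun] using hne
  · intro ω _
    exact MeasurableSet.of_discrete

theorem theorem1 (d : ℝ) (hd : 0 < d) (r : ℕ) (hr : 1 ≤ r)
    (p : ℕ → unitInterval) (hp : ∀ᶠ n : ℕ in atTop, (p n : ℝ) = d / (n : ℝ)) :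
    ∀ ε : ℝ, 0 < ε →
      Tendsto
        (fun n : ℕ => SimpleGraph.binomialRandom (Fin n) (p n)
          {G : SimpleGraph (Fin n) |
            (1 - ε) * (Real.log n / iteratedLog (r + 1) n) ≤ (G.maxDegreePower r : ℝ) ∧
            (G.maxDegreePower r : ℝ) ≤ (1 + ε) * (Real.log n / iteratedLog (r + 1) n)})
        atTop (𝓝 1) := by
  classical
  intro ε hε
  have hup := tendsto_bernoulliExp_lt_maxDegreePower hd hε hr
  -- The lower tail is estimated for `ε < 1` only; larger values of `ε` give a weaker bound.
  have hlo := tendsto_bernoulliExp_maxDegreePower_lt hd (ε := min ε (1 / 2)) (by positivity)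
    ((min_le_right _ _).trans_lt (by norm_num)) hr
  have hlim := (hlo.add hup).const_sub 1
  rw [add_zero, sub_zero] at hlim
  simp only [binomialRandom_eq_ofReal_bernoulliExp]
  rw [← ENNReal.ofReal_one]
  refine ENNReal.tendsto_ofReal (tendsto_of_tendsto_of_tendsto_of_le_of_le' hlim
    tendsto_const_nhds ?_ ?_)
  · filter_upwards [hp, (tendsto_iteratedLog 1).eventually_ge_atTop 0,
      (tendsto_iteratedLog (r + 1)).eventually_ge_atTop 0] with n hpn hlog hl
    have hM : 0 ≤ Real.log n / iteratedLog (r + 1) n := div_nonneg hlog hl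
    rw [← hpn, sub_le_iff_le_add, ← bernoulliExp_add, ← bernoulliExp_add]
    refine (bernoulliExp_const (p := p n) (A := vertexPairs (Fin n)) 1).ge.trans
      (bernoulliExp_mono (p n).2.1 (p n).2.2 fun ω => ?_)
    set Δ : ℝ := ((SimpleGraph.fromEdgeSet (ω : Set (Sym2 (Fin n)))).maxDegreePower r : ℝ)
    by_cases h1 : Δ < (1 - min ε (1 / 2)) * (Real.log n / iteratedLog (r + 1) n)
    · rw [if_pos h1]
      split_ifs <;> norm_num
    by_cases h2 : (1 + ε) * (Real.log n / iteratedLog (r + 1) n) < Δ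
    · rw [if_pos h2]
      split_ifs <;> norm_num
    rw [if_neg h1, if_neg h2, if_pos]
    · simp
    · refine ⟨le_trans ?_ (not_lt.1 h1), not_lt.1 h2⟩
      gcongr
      exact min_le_left _ _
  · refine Eventually.of_forall fun n => ?_
    refine (bernoulliExp_mono (p n).2.1 (p n).2.2 fun ω => ?_).trans_eq (bernoulliExp_const 1)
    split_ifs <;> norm_num
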